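/- Let $K$ be a field, $n\in\mathbb N$, $R=K[x_1,\dots,x_n]$, and let $I\subsetneq R$ be a proper ideal. Definitions. Let $P_n$ be the set of $\lambda\in\mathbb N^n$ with $\lambda_1\le\dots\le\lambda_n$. A monomial ideal is *symmetric* if it is fixed by all permutations of the variables. A symmetric monomial ideal $I$ is a *symmetric strongly shifted ideal* (sssi) if for all $\lambda\in P_n$ with $x^\lambda\in I$ and all $i<j$ with $\lambda_i<\lambda_j$ one has $x^\lambda x_i/x_j\in I$. For $B\subseteq P_n$, $\operatorname{Sss}(B)$ is the smallest sssi containing $x^\lambda$ for all $\lambda\in B$. The partition Borel generators of an sssi $I$ form the smallest $B\subseteq P_n$ with $I=\operatorname{Sss}(B)$, and $I$ is *principal Borel* if it has exactly one partition Borel generator. $G(I)$ denotes the set of minimal monomial generators of a monomial ideal $I$. A monomial ideal is *polymatroidal* if all elements of $G(I)$ have the same degree and, for all $u,v\in G(I)$ and every $i$ with $\deg_i(u)>\deg_i(v)$, there is $j$ with $\deg_j(u)<\deg_j(v)$ and $u x_j/x_i\in I$; here $\deg_i(u)$ is the exponent of $x_i$ in $u$. Take one variable $T_u$ for each $u\in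 G(I)$. The toric ideal of $G(I)$ is the kernel of $K[T_u:u\in G(I)]\to R$, $T_u\mapsto u$. The defining ideal of the Rees algebra $\mathcal R(I)=\bigoplus_{k\ge0}I^kt^k$ is the kernel of $R[T_u:u\in G(I)]\to\mathcal R(I)$, $T_u\mapsto ut$. The defining ideal of the fiber cone $\mathcal F(I)=\mathcal R(I)/(x_1,\dots,x_n)\mathcal R(I)$ is the kernel of the induced map $K[T_u:u\in G(I)]\to\mathcal F(I)$. The *symmetric exchange relations* of $I$ are the binomials $T_rT_s-T_tT_w$ with $r,s,t,w\in G(I)$ for which there are $i,j$ with $\deg_i(r)>\deg_i(s)$, $\deg_j(r)<\deg_j(s)$, $t=r x_j/x_i$ and $w=s x_i/x_j$. For $a,b\in\mathbb N^n$ write $a<_{\rm antilex}b$ if $|a|<|b|$, or $|a|=|b|$ and the leftmost nonzero entry of $a-b$ is positive. For a monomial $u$ let $\operatorname{part}(u)\in P_n$ be its exponent vector sorted in nondecreasing order. Write $v\prec u$ if $\operatorname{part}(v)<_{\rm antilex}\operatorname{part}(u)$, or $\operatorname{part}(v)=\operatorname{part}(u)$ and the exponent vector of $v$ is $<_{\rm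 antilex}$ that of $u$. Let $u_{\max}$ be the largest index of a variable whose exponent in $u$ is maximal among all exponents of $u$, and for $u\in G(I)$ let $C(u)=(v\in G(I):v\prec u):u$. The *linear syzygy relations* of $I$ are the elements $x_iT_u-x_{u_{\max}}T_v$ with $u,v\in G(I)$, $v\prec u$, $x_i\in C(u)$ and $x_iu=x_{u_{\max}}v$. Theorem. (1) If $I$ is a principal Borel sssi, then the toric ideal of $G(I)$ and the defining ideal of $\mathcal F(I)$ are both equal to the ideal of $K[T_u:u\in G(I)]$ generated by the (quadratic) symmetric exchange relations, and the defining ideal of $\mathcal R(I)$ is generated by the symmetric exchange relations together with the linear syzygy relations. (2) If $I$ is a symmetric polymatroidal ideal, then the toric ideal of $G(I)$ is generated by the symmetric exchange relations; that is, the White / Herzog–Hibi conjecture holds for symmetric polymatroidal ideals. -/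

import Mathlib

namespace SymShifted

noncomputable section

open MvPolynomial

variable {K : Type*} [Field K] {n : ℕ}

/-- The monomial `x^a` in `K[x_1, …, x_n]`, for an exponent vector `a`. -/
def mon (K : Type*) [Field K] {n : ℕ} (a : Fin n →₀ ℕ) : MvPolynomial (Fin n) K :=
  monomial a 1

/-- Partitions of length `n`: exponent vectors with `λ_1 ≤ ⋯ ≤ λ_n`. -/
def partitions (n : ℕ) : Set (Fin n →₀ ℕ) := {a | Monotone a}

/-- Monomial ideals: ideals generated by a set of monomials. -/
def IsMonomialIdeal (I : Ideal (MvPolynomial (Fin n) K)) : Prop :=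
  ∃ A : Set (Fin n →₀ ℕ), I = Ideal.span (mon K '' A)

/-- Ideals fixed by the symmetric group permuting the variables. -/
def IsSymmetric (I : Ideal (MvPolynomial (Fin n) K)) : Prop :=
  ∀ σ : Equiv.Perm (Fin n), I.map (rename σ : MvPolynomial (Fin n) K →ₐ[K] _) = I

/-- `P(I)`: the partitions `λ` with `x^λ ∈ I`. -/
def partitionsOf (I : Ideal (MvPolynomial (Fin n) K)) : Set (Fin n →₀ ℕ) :=
  {a | a ∈ partitions n ∧ mon K a ∈ I}

/-- Symmetric strongly shifted ideals (sssi): `x^λ x_i / x_j ∈ I` for all `λ ∈ P(I)` and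
`i < j` with `λ_i < λ_j`. -/
structure IsSssi (I : Ideal (MvPolynomial (Fin n) K)) : Prop where
  monomialIdeal : IsMonomialIdeal I
  symmetric : IsSymmetric I
  shifted : ∀ a ∈ partitionsOf I, ∀ i j : Fin n, i < j → a i < a j →
    mon K (a - Finsupp.single j 1 + Finsupp.single i 1) ∈ I

/-- `Sss(B)`: the smallest symmetric strongly shifted ideal containing `x^λ` for all `λ ∈ B`. -/
def sss (K : Type*) [Field K] {n : ℕ} (B : Set (Fin n →₀ ℕ)) :
    Ideal (MvPolynomial (Fin n) K) :=
  sInf {I | IsSssi I ∧ mon K '' B ⊆ I}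

/-- `B` is the set of partition Borel generators of `I`: the smallest set of partitions
with `I = Sss(B)`. -/
def IsBorelGenerators (I : Ideal (MvPolynomial (Fin n) K)) (B : Set (Fin n →₀ ℕ)) : Prop :=
  IsLeast {B' | B' ⊆ partitions n ∧ I = sss K B'} B

/-- Principal Borel sssi's: symmetric strongly shifted ideals with exactly one partition
Borel generator. -/
def IsPrincipalBorel (I : Ideal (MvPolynomial (Fin n) K)) : Prop :=
  IsSssi I ∧ ∃ a : Fin n →₀ ℕ, IsBorelGenerators I {a}

/-- `G(I)`: the exponent vectors of the minimal monomial generators of a monomial ideal `I`, that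
is, of the monomials of `I` that are minimal with respect to divisibility. -/
def gens (I : Ideal (MvPolynomial (Fin n) K)) : Set (Fin n →₀ ℕ) :=
  {a | Minimal (fun b => mon K b ∈ I) a}

/-- Polymatroidal ideals: monomial ideals, generated in a single degree, whose minimal monomial
generators satisfy the exchange property. -/
structure IsPolymatroidal (I : Ideal (MvPolynomial (Fin n) K)) : Prop where
  monomialIdeal : IsMonomialIdeal I
  equigenerated : ∀ u ∈ gens I, ∀ v ∈ gens I, u.degree = v.degree
  exchange : ∀ u ∈ gens I, ∀ v ∈ gens I, ∀ i, v i < u i →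
    ∃ j, u j < v j ∧ mon K (u - Finsupp.single i 1 + Finsupp.single j 1) ∈ I

/-- The toric ideal of `G(I)`: the kernel of `K[T_u : u ∈ G(I)] → K[x]`, `T_u ↦ u`. -/
def toricIdeal (I : Ideal (MvPolynomial (Fin n) K)) : Ideal (MvPolynomial (gens I) K) :=
  RingHom.ker (aeval (fun u : gens I => mon K u.1) :
    MvPolynomial (gens I) K →ₐ[K] MvPolynomial (Fin n) K)

/-- The element `u t` of the Rees algebra of `I`, for `u ∈ G(I)`. -/
def reesGen (I : Ideal (MvPolynomial (Fin n) K)) (u : gens I) : reesAlgebra I :=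
  ⟨Polynomial.monomial 1 (mon K u.1), reesAlgebra.monomial_mem.mpr (by
    simpa using (show Minimal (fun b => mon K b ∈ I) u.1 from u.2).prop)⟩

/-- The presentation `K[x][T_u : u ∈ G(I)] → R(I) = ⨁ I^k t^k` of the Rees algebra,
`T_u ↦ u t`. -/
def reesMap (I : Ideal (MvPolynomial (Fin n) K)) :
    MvPolynomial (gens I) (MvPolynomial (Fin n) K) →ₐ[MvPolynomial (Fin n) K] reesAlgebra I :=
  aeval (reesGen I)

/-- The defining ideal of the Rees algebra. -/
def reesIdeal (I : Ideal (MvPolynomial (Fin n) K)) :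
    Ideal (MvPolynomial (gens I) (MvPolynomial (Fin n) K)) :=
  RingHom.ker (reesMap I)

/-- The fiber cone `F(I) = R(I) / (x_1, …, x_n) R(I)`. -/
abbrev FiberCone (I : Ideal (MvPolynomial (Fin n) K)) : Type _ :=
  reesAlgebra I ⧸ (Ideal.span (Set.range (X : Fin n → MvPolynomial (Fin n) K))).map
    (algebraMap (MvPolynomial (Fin n) K) (reesAlgebra I))

/-- The presentation `K[T_u : u ∈ G(I)] → F(I)`, sending `T_u` to the class of `u t`. -/
def fiberMap (I : Ideal (MvPolynomial (Fin n) K)) : MvPolynomial (gens I) K →+* FiberCone I :=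
  (Ideal.Quotient.mk _).comp ((reesMap I).toRingHom.comp (MvPolynomial.map C))

/-- The defining ideal of the fiber cone. -/
def fiberIdeal (I : Ideal (MvPolynomial (Fin n) K)) : Ideal (MvPolynomial (gens I) K) :=
  RingHom.ker (fiberMap I)

/-- The symmetric exchange relations `T_r T_s - T_t T_w`, where `r, s, t, w ∈ G(I)`,
`deg_i r > deg_i s`, `deg_j r < deg_j s`, `t = r x_j / x_i` and `w = s x_i / x_j`. -/
def exchangeRelations (I : Ideal (MvPolynomial (Fin n) K)) : Set (MvPolynomial (gens I) K) :=
  {f | ∃ (r s t w : gens I) (i j : Fin n), s.1 i < r.1 i ∧ r.1 j < s.1 j ∧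
    t.1 + Finsupp.single i 1 = r.1 + Finsupp.single j 1 ∧
    w.1 + Finsupp.single j 1 = s.1 + Finsupp.single i 1 ∧
    f = X r * X s - X t * X w}

/-- `part(u)`: the entries of an exponent vector in nondecreasing order. -/
def part (u : Fin n →₀ ℕ) : Fin n → ℕ := u ∘ Tuple.sort u

/-- The antilex order: `a` is smaller than `b` if `|a| < |b|`, or `|a| = |b|` and the leftmost
nonzero entry of `a - b` is positive. -/
def AntilexLT (a b : Fin n → ℕ) : Prop :=
  ∑ i, a i < ∑ i, b i ∨
    (∑ i, a i = ∑ i, b i ∧ ∃ i, (∀ j < i, a j = b j) ∧ b i < a i)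

/-- The order `v ≺ u` on monomials: compare `part(v)` and `part(u)` first, then `v` and `u`. -/
def Prec (v u : Fin n →₀ ℕ) : Prop :=
  AntilexLT (part v) (part u) ∨ (part v = part u ∧ AntilexLT v u)

/-- `C(u) = J : u`, where `J` is generated by all `v ∈ G(I)` with `v ≺ u`. -/
def colonIdeal (I : Ideal (MvPolynomial (Fin n) K)) (u : Fin n →₀ ℕ) :
    Ideal (MvPolynomial (Fin n) K) :=
  (Ideal.span (mon K '' {v | v ∈ gens I ∧ Prec v u})).colon {mon K u}

/-- `m = u_max`: the largest index of a variable whose exponent in `u` is maximal. -/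
def IsUMax (u : Fin n →₀ ℕ) (m : Fin n) : Prop :=
  IsGreatest {k | ∀ l, u l ≤ u k} m

/-- The linear syzygy relations `x_i T_u - x_{u_max} T_v`, where `u, v ∈ G(I)`, `v ≺ u`,
`x_i ∈ C(u)` and `x_i u = x_{u_max} v`. -/
def syzygyRelations (I : Ideal (MvPolynomial (Fin n) K)) :
    Set (MvPolynomial (gens I) (MvPolynomial (Fin n) K)) :=
  {f | ∃ (u v : gens I) (i m : Fin n), IsUMax u.1 m ∧ Prec v.1 u.1 ∧
    X i ∈ colonIdeal I u.1 ∧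
    u.1 + Finsupp.single i 1 = v.1 + Finsupp.single m 1 ∧
    f = C (X i) * X u - C (X m) * X v}

end

end SymShifted

open SymShifted

namespace SymShifted

open Finset

/-- Moves one unit of `u` from position `i` to position `j`. -/
noncomputable def transfer {n : ℕ} (u : Fin n →₀ ℕ) (i j : Fin n) : Fin n →₀ ℕ :=
  u - Finsupp.single i 1 + Finsupp.single j 1

theorem transfer_add_single {n : ℕ} {u : Fin n →₀ ℕ} {i : Fin n} (j : Fin n) (h : 0 < u i) :
    transfer u i j + Finsupp.single i 1 = u + Finsupp.single j 1 := by
  ext l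
  simp only [transfer, Finsupp.add_apply, Finsupp.tsub_apply, Finsupp.single_apply]
  by_cases h1 : i = l
  · subst h1; simp; omega
  · simp [h1]

theorem eq_transfer {n : ℕ} {u v : Fin n →₀ ℕ} {i j : Fin n}
    (h : v + Finsupp.single i 1 = u + Finsupp.single j 1) (h0 : 0 < u i) : v = transfer u i j :=
  add_right_cancel (h.trans (transfer_add_single j h0).symm)

theorem transfer_src {n : ℕ} {u : Fin n →₀ ℕ} {i j : Fin n} (h : i ≠ j) :
    transfer u i j i = u i - 1 := by
  simp [transfer, h]

theorem transfer_tgt {n : ℕ} {u : Fin n →₀ ℕ} {i j : Fin n} (h : i ≠ j) :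
    transfer u i j j = u j + 1 := by
  simp [transfer, h]

theorem transfer_of_ne {n : ℕ} {u : Fin n →₀ ℕ} {i j l : Fin n} (h : l ≠ i) (h' : l ≠ j) :
    transfer u i j l = u l := by
  simp [transfer, h, h']

theorem transfer_transfer {n : ℕ} {u : Fin n →₀ ℕ} {i j : Fin n} (h : 0 < u i) :
    transfer (transfer u i j) j i = u := by
  refine (eq_transfer (transfer_add_single j h).symm ?_).symm
  simp [transfer]

theorem sum_transfer {n : ℕ} {u : Fin n →₀ ℕ} {i : Fin n} (j : Fin n) (h : 0 < u i)
    (A : Finset (Fin n)) :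
    ∑ l ∈ A, transfer u i j l + (if i ∈ A then 1 else 0) =
      ∑ l ∈ A, u l + (if j ∈ A then 1 else 0) := by
  have := congrArg (fun f : Fin n →₀ ℕ => ∑ l ∈ A, f l) (transfer_add_single j h)
  simpa [Finset.sum_add_distrib, Finsupp.single_apply] using this

theorem degree_transfer {n : ℕ} {u : Fin n →₀ ℕ} {i : Fin n} (j : Fin n) (h : 0 < u i) :
    (transfer u i j).degree = u.degree := by
  have := sum_transfer j h univ
  simp only [mem_univ, if_true] at this
  simpa [Finsupp.degree_eq_sum] using this

theorem sum_apply_transfer {n : ℕ} {u : Fin n →₀ ℕ} {i j : Fin n} (hij : i ≠ j)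
    (g : Fin n → ℕ → ℕ) :
    ∑ l, g l (transfer u i j l) + (g i (u i) + g j (u j)) =
      ∑ l, g l (u l) + (g i (u i - 1) + g j (u j + 1)) := by
  have key : ∀ v : Fin n →₀ ℕ, ∑ l, g l (v l) =
      ∑ l ∈ (univ.erase i).erase j, g l (v l) + (g i (v i) + g j (v j)) := by
    intro v
    rw [← Finset.add_sum_erase univ (fun l => g l (v l)) (mem_univ i),
      ← Finset.add_sum_erase (univ.erase i) (fun l => g l (v l)) (a := j)
        (by simp [hij.symm])]
    ring
  rw [key, key u, transfer_src hij, transfer_tgt hij]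
  have : ∑ l ∈ (univ.erase i).erase j, g l (transfer u i j l) =
      ∑ l ∈ (univ.erase i).erase j, g l (u l) := by
    refine Finset.sum_congr rfl fun l hl => ?_
    simp only [mem_erase] at hl
    rw [transfer_of_ne hl.2.1 hl.1]
  rw [this]
  ring

/-- The sum of the first `p` terms of `ℓ`. -/
def prefixSum (ℓ : ℕ → ℕ) (p : ℕ) : ℕ := ∑ q ∈ range p, ℓ q

theorem prefixSum_submodular {α : Type*} [DecidableEq α] {ℓ : ℕ → ℕ} (hℓ : Antitone ℓ)
    (A B : Finset α) :
    prefixSum ℓ (A ∪ B).card + prefixSum ℓ (A ∩ B).card ≤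
      prefixSum ℓ A.card + prefixSum ℓ B.card := by
  obtain ⟨y, hy⟩ := Nat.exists_eq_add_of_le (card_le_card (inter_subset_right : A ∩ B ⊆ B))
  have h := card_union_add_card_inter A B
  have h1 : (A ∪ B).card = A.card + y := by omega
  have hx := card_le_card (inter_subset_left : A ∩ B ⊆ A)
  rw [h1, hy]
  simp only [prefixSum, sum_range_add]
  have : ∑ x ∈ range y, ℓ (A.card + x) ≤ ∑ x ∈ range y, ℓ ((A ∩ B).card + x) :=
    sum_le_sum fun q _ => hℓ (by omega)
  omega

theorem prefixSum_le_line {ℓ : ℕ → ℕ} {L m : ℕ} (h₁ : ∀ q, m ≤ q → ℓ q ≤ L)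
    (h₂ : ∀ q, q < m → L ≤ ℓ q) (p : ℕ) :
    prefixSum ℓ p + L * m ≤ prefixSum ℓ m + L * p := by
  rcases le_total m p with h | h
  · obtain ⟨t, rfl⟩ := Nat.exists_eq_add_of_le h
    have : ∑ x ∈ range t, ℓ (m + x) ≤ ∑ x ∈ range t, L :=
      sum_le_sum fun q _ => h₁ _ (by omega)
    simp only [sum_const, card_range, smul_eq_mul] at this
    simp only [prefixSum, sum_range_add]
    nlinarith
  · obtain ⟨t, rfl⟩ := Nat.exists_eq_add_of_le h
    have : ∑ x ∈ range t, L ≤ ∑ x ∈ range t, ℓ (p + x) :=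
      sum_le_sum fun q hq => h₂ _ (by have := mem_range.1 hq; omega)
    simp only [sum_const, card_range, smul_eq_mul] at this
    simp only [prefixSum, sum_range_add]
    nlinarith

/-- The lattice points of the permutohedron of `(ℓ 0, …, ℓ (n - 1))`: the vectors majorized by
this one, when `ℓ` is antitone. -/
def base (n : ℕ) (ℓ : ℕ → ℕ) : Set (Fin n →₀ ℕ) :=
  {u | u.degree = prefixSum ℓ n ∧ ∀ A : Finset (Fin n), ∑ i ∈ A, u i ≤ prefixSum ℓ A.card}

section Base

variable {n : ℕ} {ℓ : ℕ → ℕ} {u v : Fin n →₀ ℕ}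

theorem transfer_mem_base {i j : Fin n} (hu : u ∈ base n ℓ) (hi : 0 < u i)
    (h : ∀ A : Finset (Fin n), ∑ l ∈ A, u l = prefixSum ℓ A.card → j ∈ A → i ∈ A) :
    transfer u i j ∈ base n ℓ := by
  refine ⟨(degree_transfer j hi).trans hu.1, fun A => ?_⟩
  have h1 := sum_transfer j hi A
  have h2 := hu.2 A
  have h3 := h A
  by_cases hj : j ∈ A <;> by_cases hi : i ∈ A <;> simp [hj, hi] at h1 h3 <;> omega

theorem transfer_mem_base_of_lt {i j : Fin n} (hu : u ∈ base n ℓ) (hij : u j < u i) :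
    transfer u i j ∈ base n ℓ := by
  refine transfer_mem_base hu (by omega) fun A hA hj => ?_
  by_contra hi
  have h1 := hu.2 (insert i (A.erase j))
  have hne : i ∉ A.erase j := fun h => hi (mem_of_mem_erase h)
  rw [sum_insert hne, card_insert_of_notMem hne, card_erase_of_mem hj] at h1
  have h2 := add_sum_erase A u hj
  have h3 : 0 < A.card := card_pos.2 ⟨j, hj⟩
  rw [Nat.sub_add_cancel h3] at h1
  omega

theorem tight_union_inter (hℓ : Antitone ℓ) (hu : u ∈ base n ℓ) {A B : Finset (Fin n)}
    (hA : ∑ l ∈ A, u l = prefixSum ℓ A.card) (hB : ∑ l ∈ B, u l = prefixSum ℓ B.card) :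
    ∑ l ∈ A ∪ B, u l = prefixSum ℓ (A ∪ B).card ∧
      ∑ l ∈ A ∩ B, u l = prefixSum ℓ (A ∩ B).card := by
  have h1 := sum_union_inter (s₁ := A) (s₂ := B) (f := u)
  have h2 := prefixSum_submodular hℓ A B
  have h3 := hu.2 (A ∪ B)
  have h4 := hu.2 (A ∩ B)
  omega

/-- The symmetric exchange property. -/
theorem base_exchange (hℓ : Antitone ℓ) (hu : u ∈ base n ℓ) (hv : v ∈ base n ℓ) {i : Fin n}
    (hi : v i < u i) :
    ∃ j, u j < v j ∧ transfer u i j ∈ base n ℓ ∧ transfer v j i ∈ base n ℓ := by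
  obtain ⟨B, hB, hBmax⟩ := exists_max_image
    (univ.filter fun A : Finset (Fin n) => ∑ l ∈ A, u l = prefixSum ℓ A.card ∧ i ∉ A) card
    ⟨∅, mem_filter.2 ⟨mem_univ _, by simp [prefixSum], notMem_empty _⟩⟩
  obtain ⟨A, hA, hAmin⟩ := exists_min_image
    (univ.filter fun A : Finset (Fin n) => ∑ l ∈ A, v l = prefixSum ℓ A.card ∧ i ∈ A) card
    ⟨univ, by simpa [Finsupp.degree_eq_sum] using hv.1⟩
  simp only [mem_filter, mem_univ, true_and] at hA hB hAmin hBmax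
  have hBmax' : ∀ D : Finset (Fin n), ∑ l ∈ D, u l = prefixSum ℓ D.card → i ∉ D → D ⊆ B := by
    intro D hD hiD
    have h := hBmax (B ∪ D) ⟨(tight_union_inter hℓ hu hB.1 hD).1, by simp [hB.2, hiD]⟩
    rw [eq_of_subset_of_card_le subset_union_left h]
    exact subset_union_right
  have hAmin' : ∀ D : Finset (Fin n), ∑ l ∈ D, v l = prefixSum ℓ D.card → i ∈ D → A ⊆ D := by
    intro D hD hiD
    have h := hAmin (A ∩ D) ⟨(tight_union_inter hℓ hv hA.1 hD).2, by simp [hA.2, hiD]⟩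
    rw [← eq_of_subset_of_card_le inter_subset_left h]
    exact inter_subset_right
  have hlt : ∃ j ∈ A \ B, u j < v j := by
    by_contra! hcon
    have h1 : ∑ l ∈ A \ B, v l < ∑ l ∈ A \ B, u l :=
      sum_lt_sum hcon ⟨i, by simp [hA.2, hB.2], hi⟩
    have h2 := hu.2 (A ∪ B)
    have h3 := hv.2 (A ∩ B)
    have h4 := prefixSum_submodular hℓ A B
    have h5 : ∑ l ∈ A \ B, u l + ∑ l ∈ B, u l = ∑ l ∈ A ∪ B, u l := by
      rw [← sum_union sdiff_disjoint, sdiff_union_self_eq_union]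
    have h6 : ∑ l ∈ A ∩ B, v l + ∑ l ∈ A \ B, v l = ∑ l ∈ A, v l :=
      sum_inter_add_sum_sdiff _ _ _
    have h7 := hA.1
    have h8 := hB.1
    omega
  obtain ⟨j, hj, hjlt⟩ := hlt
  rw [mem_sdiff] at hj
  refine ⟨j, hjlt, transfer_mem_base hu (by omega) fun D hD hjD => ?_,
    transfer_mem_base hv (by omega) fun D hD hiD => hAmin' D hD hiD hj.1⟩
  by_contra hiD
  exact hj.2 (hBmax' D hD hiD hjD)

/-- For vectors between `c` and `c + 1`, membership in the base only has to be tested on the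
superlevel sets of `c`. -/
theorem mem_base_of_level (hℓ : Antitone ℓ) {c : Fin n → ℕ} (hdeg : u.degree = prefixSum ℓ n)
    (hc : ∀ l, c l ≤ u l ∧ u l ≤ c l + 1)
    (hlev : ∀ t, ∑ l ∈ univ.filter (fun l => t ≤ c l), u l ≤
      prefixSum ℓ (univ.filter (fun l => t ≤ c l)).card) : u ∈ base n ℓ := by
  refine ⟨hdeg, ?_⟩
  by_contra! hcon
  obtain ⟨A₀, hA₀⟩ := hcon
  obtain ⟨A, -, hmax⟩ := exists_max_image (univ : Finset (Finset (Fin n)))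
    (fun A => (∑ l ∈ A, u l : ℤ) - prefixSum ℓ A.card) ⟨∅, mem_univ _⟩
  have hpos : prefixSum ℓ A.card < ∑ l ∈ A, u l := by
    have := hmax A₀ (mem_univ _)
    zify at hA₀ ⊢
    linarith
  obtain ⟨m, hm⟩ : ∃ m, A.card = m + 1 := by
    refine Nat.exists_eq_succ_of_ne_zero fun h0 => ?_
    rw [card_eq_zero] at h0
    subst h0
    simp [prefixSum] at hpos
  set L := ℓ m with hL
  have hin : ∀ x ∈ A, L ≤ u x := by
    intro x hx
    have h1 := hmax (A.erase x) (mem_univ _)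
    have h2 := add_sum_erase A u hx
    rw [card_erase_of_mem hx, hm, Nat.add_sub_cancel, prefixSum, prefixSum,
      sum_range_succ] at h1
    zify at h2 ⊢
    push_cast at h1
    linarith
  have hout : ∀ x ∉ A, u x ≤ L := by
    intro x hx
    have h1 := hmax (insert x A) (mem_univ _)
    rw [card_insert_of_notMem hx, sum_insert hx, prefixSum, prefixSum, sum_range_succ] at h1
    have h2 : ℓ A.card ≤ L := hℓ (by omega)
    zify at h2 ⊢
    push_cast at h1
    linarith
  set B := univ.filter (fun l => L ≤ c l) with hB
  have h1 := hlev L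
  rw [← hB] at h1
  have h2 := prefixSum_le_line (ℓ := ℓ) (L := L) (m := A.card) (fun q hq => hℓ (by omega))
    (fun q hq => hℓ (by omega)) B.card
  have h3 : ∑ l ∈ B \ A, u l = (B \ A).card * L := by
    refine sum_const_nat fun x hx => ?_
    simp only [hB, mem_sdiff, mem_filter, mem_univ, true_and] at hx
    have := hout x hx.2
    have := (hc x).1
    omega
  have h4 : ∑ l ∈ A \ B, u l = (A \ B).card * L := by
    refine sum_const_nat fun x hx => ?_
    simp only [hB, mem_sdiff, mem_filter, mem_univ, true_and] at hx
    have := hin x hx.1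
    have := (hc x).2
    omega
  have h5 : ∑ l ∈ A ∩ B, u l + ∑ l ∈ A \ B, u l = ∑ l ∈ A, u l := sum_inter_add_sum_sdiff _ _ _
  have h6 : ∑ l ∈ B ∩ A, u l + ∑ l ∈ B \ A, u l = ∑ l ∈ B, u l := sum_inter_add_sum_sdiff _ _ _
  have h7 := card_inter_add_card_sdiff A B
  have h8 := card_inter_add_card_sdiff B A
  rw [inter_comm] at h6 h8
  rw [← h7] at h2
  nth_rewrite 2 [← h8] at h2
  rw [h7] at h2
  rw [h3] at h6
  rw [h4] at h5
  nlinarith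

theorem mapDomain_mem_base (σ : Equiv.Perm (Fin n)) (hu : u ∈ base n ℓ) :
    Finsupp.mapDomain σ u ∈ base n ℓ := by
  refine ⟨?_, fun A => ?_⟩
  · rw [← hu.1, Finsupp.degree_eq_sum, Finsupp.degree_eq_sum]
    simp only [Finsupp.mapDomain_equiv_apply]
    exact Equiv.sum_comp σ.symm u
  · have := hu.2 (A.map σ.symm.toEmbedding)
    simpa [Finsupp.mapDomain_equiv_apply] using this

/-- Every vector majorized by `ℓ` is obtained from `ℓ` by permutations and transfers from larger
to smaller entries. -/
theorem base_subset (hℓ : Antitone ℓ) {Q : Set (Fin n →₀ ℕ)}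
    (hperm : ∀ u ∈ Q, ∀ σ : Equiv.Perm (Fin n), Finsupp.mapDomain σ u ∈ Q)
    (htr : ∀ u ∈ Q, ∀ i j, u j < u i → transfer u i j ∈ Q) {w : Fin n →₀ ℕ}
    (hw : ∀ i, w i = ℓ i) (hwb : w ∈ base n ℓ) (hwQ : w ∈ Q) : base n ℓ ⊆ Q := by
  have hbound : ∀ u ∈ base n ℓ, ∑ l, u l ^ 2 ≤ n * prefixSum ℓ n ^ 2 := by
    intro u hu
    have : ∑ l, u l ^ 2 ≤ ∑ l : Fin n, prefixSum ℓ n ^ 2 := by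
      refine sum_le_sum fun l _ => Nat.pow_le_pow_left ?_ 2
      rw [← hu.1]
      exact Finsupp.le_degree l u
    simpa using this
  suffices H : ∀ N u, u ∈ base n ℓ → n * prefixSum ℓ n ^ 2 - ∑ l, u l ^ 2 = N → u ∈ Q from
    fun u hu => H _ u hu rfl
  intro N
  induction N using Nat.strong_induction_on with
  | _ N ih =>
    intro u hu hN
    set σ := Tuple.sort (fun i => OrderDual.toDual (u i))
    have hmono : ∀ p q : Fin n, p ≤ q → u (σ q) ≤ u (σ p) :=
      fun p q h => Tuple.monotone_sort (fun i => OrderDual.toDual (u i)) h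
    set x := Finsupp.mapDomain σ.symm u with hx
    have hxap : ∀ p, x p = u (σ p) := fun p => by simp [hx, Finsupp.mapDomain_equiv_apply]
    have hxb : x ∈ base n ℓ := mapDomain_mem_base _ hu
    have hxu : Finsupp.mapDomain σ x = u := by
      ext p; simp [Finsupp.mapDomain_equiv_apply, hxap]
    have hsq : ∑ l, x l ^ 2 = ∑ l, u l ^ 2 := by
      simp only [hxap]
      exact Equiv.sum_comp σ (fun l => u l ^ 2)
    rw [← hxu]
    refine hperm _ ?_ σ
    by_cases hxw : x = w
    · rwa [hxw]
    obtain ⟨i, hi, himin⟩ : ∃ i, x i ≠ w i ∧ ∀ j < i, x j = w j := by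
      have hne : (univ.filter fun i => x i ≠ w i).Nonempty := by
        by_contra h
        rw [not_nonempty_iff_eq_empty, filter_eq_empty_iff] at h
        exact hxw (Finsupp.ext fun i => not_not.1 (h (mem_univ i)))
      refine ⟨_, (mem_filter.1 (min'_mem _ hne)).2, fun j hj => ?_⟩
      by_contra h
      exact absurd (min'_le _ j (mem_filter.2 ⟨mem_univ _, h⟩)) (not_le.2 hj)
    have hilt : x i < w i := by
      refine lt_of_le_of_ne ?_ hi
      have h1 := hxb.2 (Iic i)
      have h2 : ∑ l ∈ Iic i, w l = prefixSum ℓ (Iic i).card := by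
        rw [Fin.card_Iic, prefixSum, sum_congr rfl fun l _ => hw l]
        have : range (i.1 + 1) = (Iic i).map Fin.valEmbedding := by
          ext q
          simp only [mem_range, Fin.map_valEmbedding_Iic, mem_Iic]
          omega
        rw [this, sum_map]
        rfl
      have h3 : ∑ l ∈ Iio i, x l = ∑ l ∈ Iio i, w l :=
        sum_congr rfl fun j hj => himin j (mem_Iio.1 hj)
      rw [← h2, ← Iio_insert, sum_insert (by simp), sum_insert (by simp)] at h1
      omega
    obtain ⟨j, hj, -, hjb⟩ := base_exchange hℓ hwb hxb hilt
    have hij : i < j := by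
      by_contra h
      rcases eq_or_lt_of_le (not_lt.1 h) with rfl | h
      · omega
      · have := himin j h
        omega
    have hxij : x j ≤ x i := by rw [hxap, hxap]; exact hmono _ _ hij.le
    have hj0 : 0 < x j := by omega
    have h1 := sum_apply_transfer (u := x) hij.ne' (fun _ t => t ^ 2)
    have h2 := hbound _ hjb
    have h3 := hbound _ hu
    have h4 : ∑ l, x l ^ 2 < ∑ l, transfer x j i l ^ 2 := by
      obtain ⟨t, ht⟩ := Nat.exists_eq_succ_of_ne_zero hj0.ne'
      simp only [ht, Nat.succ_sub_one] at h1
      nlinarith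
    have := ih (n * prefixSum ℓ n ^ 2 - ∑ l, transfer x j i l ^ 2) (by omega) _ hjb rfl
    have h5 := htr _ this i j (by rw [transfer_src hij.ne', transfer_tgt hij.ne']; omega)
    rwa [transfer_transfer hj0] at h5

end Base

end SymShifted
namespace SymShifted

open Finset

@[to_additive]
theorem prod_update_update {ι α M : Type*} [Fintype ι] [DecidableEq ι] [CommMonoid M] (U : ι → α)
    {a b : ι} (hab : a ≠ b) (x y : α) (g : ι → α → M) :
    (∏ c, g c (Function.update (Function.update U a x) b y c)) * (g a (U a) * g b (U b)) =
      (∏ c, g c (U c)) * (g a x * g b y) := by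
  have key : ∀ V : ι → α, ∏ c, g c (V c) =
      g a (V a) * g b (V b) * ∏ c ∈ (univ.erase a).erase b, g c (V c) := by
    intro V
    rw [← mul_prod_erase univ (fun c => g c (V c)) (mem_univ a),
      ← mul_prod_erase (univ.erase a) (fun c => g c (V c)) (a := b) (by simp [hab.symm]),
      mul_assoc]
  have h : ∏ c ∈ (univ.erase a).erase b,
      g c (Function.update (Function.update U a x) b y c) =
        ∏ c ∈ (univ.erase a).erase b, g c (U c) := by
    refine prod_congr rfl fun c hc => ?_
    simp only [mem_erase] at hc
    rw [Function.update_of_ne hc.1, Function.update_of_ne hc.2.1]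
  rw [key, key U, h, Function.update_self, Function.update_of_ne hab, Function.update_self]
  ac_rfl

/-- The sum of the members of a family of exponent vectors. -/
noncomputable def total {n k : ℕ} {G : Set (Fin n →₀ ℕ)} (U : Fin k → G) : Fin n →₀ ℕ :=
  ∑ c, (U c).1

theorem total_apply {n k : ℕ} {G : Set (Fin n →₀ ℕ)} (U : Fin k → G) (i : Fin n) :
    total U i = ∑ c, (U c).1 i := by
  simp [total, Finsupp.finsetSum_apply]

/-- Sets of families which are closed under symmetric exchanges between two of their members. -/
def ExchangeClosed {n k : ℕ} {G : Set (Fin n →₀ ℕ)} (S : Set (Fin k → G)) : Prop :=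
  ∀ U ∈ S, ∀ a b : Fin k, a ≠ b → ∀ i j, (U b).1 i < (U a).1 i → (U a).1 j < (U b).1 j →
    ∀ t w : G, t.1 = transfer (U a).1 i j → w.1 = transfer (U b).1 j i →
      Function.update (Function.update U a t) b w ∈ S

section Exchange

variable {n k : ℕ} {ℓ : ℕ → ℕ} {G : Set (Fin n →₀ ℕ)}

theorem total_exchange {U : Fin k → G} {a b : Fin k} (hab : a ≠ b) {i j : Fin n}
    (hi : 0 < (U a).1 i) (hj : 0 < (U b).1 j) {t w : G} (ht : t.1 = transfer (U a).1 i j)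
    (hw : w.1 = transfer (U b).1 j i) :
    total (Function.update (Function.update U a t) b w) = total U := by
  have h := sum_update_update U hab t w (fun _ u => u.1)
  have h1 := transfer_add_single j hi
  have h2 := transfer_add_single i hj
  rw [← ht] at h1
  rw [← hw] at h2
  have h3 : t.1 + w.1 = (U a).1 + (U b).1 := by
    apply add_right_cancel (b := Finsupp.single i 1 + Finsupp.single j 1)
    calc _ = (t.1 + Finsupp.single i 1) + (w.1 + Finsupp.single j 1) := by abel
      _ = _ := by rw [h1, h2]; abel
  rw [h3] at h
  exact add_right_cancel h

/-- Minimal families with respect to the sum of squares are balanced. -/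
theorem exists_balanced (hℓ : Antitone ℓ) (hG : G = base n ℓ) {S : Set (Fin k → G)}
    (hS : ExchangeClosed S) (hne : S.Nonempty) :
    ∃ U ∈ S, ∀ a b i, (U a).1 i ≤ (U b).1 i + 1 := by
  subst hG
  obtain ⟨U, hU, hmin⟩ := exists_minimalFor_of_wellFoundedLT (· ∈ S)
    (fun U => ∑ c, ∑ l, (U c).1 l ^ 2) hne
  refine ⟨U, hU, fun a b i => ?_⟩
  by_contra! hlt
  have hab : a ≠ b := by rintro rfl; omega
  obtain ⟨j, hj, h1, h2⟩ := base_exchange hℓ (U a).2 (U b).2 (i := i) (by omega)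
  have hij : i ≠ j := by rintro rfl; omega
  have hmem := hS U hU a b hab i j (by omega) hj ⟨_, h1⟩ ⟨_, h2⟩ rfl rfl
  have h3 := sum_update_update U hab ⟨_, h1⟩ ⟨_, h2⟩ (fun _ u => ∑ l, u.1 l ^ 2)
  have h4 := sum_apply_transfer (u := (U a).1) hij (fun _ x => x ^ 2)
  have h5 := sum_apply_transfer (u := (U b).1) hij.symm (fun _ x => x ^ 2)
  have h6 := hmin hmem
  obtain ⟨x, hx⟩ : ∃ x, (U a).1 i = x + 1 := ⟨_, (Nat.sub_add_cancel (by omega)).symm⟩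
  obtain ⟨y, hy⟩ : ∃ y, (U b).1 j = y + 1 := ⟨_, (Nat.sub_add_cancel (by omega)).symm⟩
  simp only [hx, hy, Nat.add_sub_cancel] at h3 h4 h5 h6 hlt hj
  have h7 := h6 (by nlinarith)
  nlinarith

theorem balanced_bounds {U : Fin k → G} (h : ∀ a b i, (U a).1 i ≤ (U b).1 i + 1) (a : Fin k)
    (i : Fin n) : total U i / k ≤ (U a).1 i ∧ (U a).1 i ≤ total U i / k + 1 := by
  have hk : 0 < k := a.pos
  rw [total_apply]
  constructor
  · rw [← Nat.lt_succ_iff, Nat.div_lt_iff_lt_mul hk]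
    calc ∑ c, (U c).1 i < ∑ c : Fin k, ((U a).1 i + 1) :=
          sum_lt_sum (fun c _ => h c a i) ⟨a, mem_univ _, by omega⟩
      _ = _ := by simp [mul_comm]
  · by_contra! hlt
    have h1 : ∑ c : Fin k, ((∑ c, (U c).1 i) / k + 1) ≤ ∑ c, (U c).1 i :=
      sum_le_sum fun c _ => by have := h a c i; omega
    rw [sum_const, card_univ, Fintype.card_fin, smul_eq_mul] at h1
    exact absurd h1 (not_le.2 (Nat.lt_mul_div_succ _ hk))

/-- The first `p` positions in the order given by `σ`. -/
def initialSet (σ : Equiv.Perm (Fin n)) (p : ℕ) : Finset (Fin n) :=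
  univ.filter fun i => (σ.symm i).1 < p

/-- The sum of the first `p` entries in the order given by `σ`. -/
def initialSum (σ : Equiv.Perm (Fin n)) (u : Fin n →₀ ℕ) (p : ℕ) : ℕ :=
  ∑ i ∈ initialSet σ p, u i

theorem initialSum_zero (σ : Equiv.Perm (Fin n)) (u : Fin n →₀ ℕ) : initialSum σ u 0 = 0 := by
  simp [initialSum, initialSet]

theorem initialSum_last (σ : Equiv.Perm (Fin n)) (u : Fin n →₀ ℕ) :
    initialSum σ u n = u.degree := by
  simp [initialSum, initialSet, Finsupp.degree_eq_sum]

theorem initialSum_succ (σ : Equiv.Perm (Fin n)) (u : Fin n →₀ ℕ) (p : Fin n) :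
    initialSum σ u (p + 1) = initialSum σ u p + u (σ p) := by
  have : initialSet σ (p + 1) = insert (σ p) (initialSet σ p) := by
    ext i
    simp only [initialSet, mem_filter, mem_univ, true_and, mem_insert, Nat.lt_succ_iff_lt_or_eq,
      ← Equiv.symm_apply_eq, Fin.ext_iff]
    tauto
  rw [initialSum, this, sum_insert (by simp [initialSet]), add_comm]
  rfl

theorem initialSum_sum {ι : Type*} (s : Finset ι) (σ : Equiv.Perm (Fin n))
    (u : ι → Fin n →₀ ℕ) (p : ℕ) :
    initialSum σ (∑ c ∈ s, u c) p = ∑ c ∈ s, initialSum σ (u c) p := by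
  simp only [initialSum, Finsupp.finsetSum_apply]
  exact sum_comm

theorem exists_initialSet_eq {σ : Equiv.Perm (Fin n)} {c : Fin n → ℕ}
    (hc : ∀ p q : Fin n, p ≤ q → c (σ q) ≤ c (σ p)) (t : ℕ) :
    ∃ p, univ.filter (fun l => t ≤ c l) = initialSet σ p := by
  have hex : ∃ p : ℕ, ∀ q : Fin n, p ≤ q → c (σ q) < t := ⟨n, fun q hq => by omega⟩
  classical
  refine ⟨Nat.find hex, ?_⟩
  ext l
  simp only [initialSet, mem_filter, mem_univ, true_and]
  constructor
  · intro hl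
    by_contra h
    have := Nat.find_spec hex (σ.symm l) (not_lt.1 h)
    rw [Equiv.apply_symm_apply] at this
    omega
  · intro hl
    have h := Nat.find_min hex hl
    push Not at h
    obtain ⟨q, hq, hqt⟩ := h
    have := hc (σ.symm l) q hq
    rw [Equiv.apply_symm_apply] at this
    omega

theorem exists_excursion {D : ℕ → ℤ} {t : ℤ} {m p : ℕ} (h0 : D 0 < t) (hm : D m < t) (hp : p ≤ m)
    (ht : t ≤ D p) :
    ∃ α β, α < β ∧ β < m ∧ D α < t ∧ D (β + 1) < t ∧ ∀ q, α < q → q ≤ β → t ≤ D q := by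
  classical
  have hex : ∃ q, p ≤ q ∧ D q < t := ⟨m, hp, hm⟩
  have hspec := Nat.find_spec hex
  have hmin := fun q => Nat.find_min (H := hex) (m := q)
  have hle : Nat.find hex ≤ m := Nat.find_min' hex ⟨hp, hm⟩
  set γ := Nat.find hex
  have hα := Nat.findGreatest_spec (P := fun q => D q < t) (n := p) (Nat.zero_le p) h0
  have hαle := Nat.findGreatest_le (P := fun q => D q < t) p
  have hgt := fun q => Nat.findGreatest_is_greatest (P := fun q => D q < t) (n := p) (k := q)
  set α := Nat.findGreatest (fun q => D q < t) p
  have hαp : α ≠ p := fun h => by rw [h] at hα; omega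
  have hpγ : p ≠ γ := fun h => by rw [← h] at hspec; omega
  refine ⟨α, γ - 1, by omega, by omega, hα, ?_, fun q h1 h2 => ?_⟩
  · rw [Nat.sub_add_cancel (by omega)]
    exact hspec.2
  · rcases le_total q p with h | h
    · exact not_lt.1 (hgt q h1 h)
    · exact not_lt.1 fun h3 => hmin q (by omega) ⟨h, h3⟩

theorem initialSum_transfer {σ : Equiv.Perm (Fin n)} {u : Fin n →₀ ℕ} {α β : Fin n}
    (h : 0 < u (σ α)) (p : ℕ) :
    initialSum σ (transfer u (σ α) (σ β)) p + (if α.1 < p then 1 else 0) =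
      initialSum σ u p + (if β.1 < p then 1 else 0) := by
  have := sum_transfer (σ β) h (initialSet σ p)
  simpa only [initialSum, initialSet, mem_filter, mem_univ, true_and, Equiv.symm_apply_apply]
    using this

theorem exists_exchange_of_excess (hℓ : Antitone ℓ) {σ : Equiv.Perm (Fin n)} {c : Fin n → ℕ}
    (hc : ∀ p q : Fin n, p ≤ q → c (σ q) ≤ c (σ p)) {r s : Fin n →₀ ℕ} (hr : r ∈ base n ℓ)
    (hs : s ∈ base n ℓ) (hrc : ∀ l, c l ≤ r l ∧ r l ≤ c l + 1)
    (hsc : ∀ l, c l ≤ s l ∧ s l ≤ c l + 1) {t : ℕ} (ht : 1 ≤ t) {p : ℕ} (hp : p ≤ n)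
    (hexc : initialSum σ s p + t ≤ initialSum σ r p) :
    ∃ α β : Fin n, α < β ∧ s (σ α) < r (σ α) ∧ r (σ β) < s (σ β) ∧
      transfer r (σ α) (σ β) ∈ base n ℓ ∧ transfer s (σ β) (σ α) ∈ base n ℓ ∧
      ∀ q, α.1 < q → q ≤ β.1 → initialSum σ s q + t ≤ initialSum σ r q := by
  obtain ⟨α, β, hαβ, hβ, h1, h2, h3⟩ := exists_excursion
    (D := fun q => (initialSum σ r q : ℤ) - initialSum σ s q) (t := t) (m := n) (p := p)
    (by simp [initialSum_zero]; omega) (by simp [initialSum_last, hr.1, hs.1]; omega) hp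
    (by zify at hexc; linarith)
  have h4 := initialSum_succ σ r ⟨α, by omega⟩
  have h5 := initialSum_succ σ s ⟨α, by omega⟩
  have h6 := initialSum_succ σ r ⟨β, hβ⟩
  have h7 := initialSum_succ σ s ⟨β, hβ⟩
  have h8 := h3 (α + 1) (by omega) (by omega)
  have h9 := h3 β hαβ le_rfl
  simp only at h4 h5 h6 h7
  rw [h4, h5] at h8
  rw [h6, h7] at h2
  push_cast at h8 h2
  have hα' : s (σ ⟨α, by omega⟩) < r (σ ⟨α, by omega⟩) := by zify; linarith
  have hβ' : r (σ ⟨β, hβ⟩) < s (σ ⟨β, hβ⟩) := by zify; linarith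
  have h10 := hrc (σ ⟨α, by omega⟩)
  have h11 := hrc (σ ⟨β, by omega⟩)
  have h12 := hsc (σ ⟨α, by omega⟩)
  have h13 := hsc (σ ⟨β, by omega⟩)
  have h14 := hc ⟨α, by omega⟩ ⟨β, hβ⟩ (by simpa using hαβ.le)
  have hne : σ ⟨β, hβ⟩ ≠ σ ⟨α, by omega⟩ := fun h => by
    have := σ.injective h
    simp at this
    omega
  refine ⟨⟨α, by omega⟩, ⟨β, hβ⟩, by simpa using hαβ, hα', hβ',
    transfer_mem_base_of_lt hr (by omega), ?_, fun q h h' => by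
      have := h3 q h h'
      zify
      linarith⟩
  refine mem_base_of_level hℓ ((degree_transfer _ (by omega)).trans hs.1) (c := c)
    (fun l => ?_) fun v => ?_
  · by_cases e1 : l = σ ⟨β, hβ⟩
    · subst e1
      rw [transfer_src hne]
      omega
    · by_cases e2 : l = σ ⟨α, by omega⟩
      · subst e2
        rw [transfer_tgt hne]
        omega
      · rw [transfer_of_ne e1 e2]
        exact hsc l
  · obtain ⟨q, hq⟩ := exists_initialSet_eq hc v
    rw [hq]
    change initialSum σ _ q ≤ _
    have e1 := initialSum_transfer (σ := σ) (u := s) (α := ⟨β, hβ⟩) (β := ⟨α, by omega⟩)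
      (by omega) q
    have e2 := hs.2 (initialSet σ q)
    have e3 := hr.2 (initialSet σ q)
    change initialSum σ s q ≤ _ at e2
    change initialSum σ r q ≤ _ at e3
    have e4 := h3 q
    simp only at e1 e4
    split_ifs at e1 <;> omega

/-- The potential whose minima are the sorted families. -/
def sortPotential {k : ℕ} {G : Set (Fin n →₀ ℕ)} (σ : Equiv.Perm (Fin n)) (U : Fin k → G) : ℕ :=
  ∑ a, ∑ p ∈ range (n + 1), (k * initialSum σ (U a).1 p + (k - a.1)) ^ 2

theorem sortPotential_exchange {σ : Equiv.Perm (Fin n)} {U : Fin k → G} {a b : Fin k} (hab : a ≠ b)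
    {t : ℕ} (ht : k + (k - b.1) < k * t + (k - a.1)) {α β : Fin n} (hαβ : α < β)
    (hα : 0 < (U a).1 (σ α)) (hβ : 0 < (U b).1 (σ β)) {r s : G}
    (hr : r.1 = transfer (U a).1 (σ α) (σ β)) (hs : s.1 = transfer (U b).1 (σ β) (σ α))
    (hexc : ∀ q, α.1 < q → q ≤ β.1 → initialSum σ (U b).1 q + t ≤ initialSum σ (U a).1 q) :
    sortPotential σ (Function.update (Function.update U a r) b s) < sortPotential σ U := by
  have h := sum_update_update U hab r s
    (fun c u => ∑ p ∈ range (n + 1), (k * initialSum σ u.1 p + (k - c.1)) ^ 2)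
  have key : ∑ p ∈ range (n + 1), (k * initialSum σ r.1 p + (k - a.1)) ^ 2 +
      ∑ p ∈ range (n + 1), (k * initialSum σ s.1 p + (k - b.1)) ^ 2 <
      ∑ p ∈ range (n + 1), (k * initialSum σ (U a).1 p + (k - a.1)) ^ 2 +
      ∑ p ∈ range (n + 1), (k * initialSum σ (U b).1 p + (k - b.1)) ^ 2 := by
    rw [← sum_add_distrib, ← sum_add_distrib]
    have hk := a.pos
    have hin : ∀ p, α.1 < p → p ≤ β.1 →
        (k * initialSum σ r.1 p + (k - a.1)) ^ 2 + (k * initialSum σ s.1 p + (k - b.1)) ^ 2 <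
        (k * initialSum σ (U a).1 p + (k - a.1)) ^ 2 +
          (k * initialSum σ (U b).1 p + (k - b.1)) ^ 2 := by
      intro p h1 h2
      have e1 := initialSum_transfer (β := β) hα p
      have e2 := initialSum_transfer (β := α) hβ p
      rw [← hr] at e1
      rw [← hs] at e2
      rw [if_pos h1, if_neg (by omega)] at e1
      rw [if_pos h1, if_neg (by omega)] at e2
      rw [add_zero] at e1 e2
      have e3 := hexc p h1 h2
      rw [← e1] at e3 ⊢
      rw [e2]
      generalize initialSum σ r.1 p = x at *
      generalize initialSum σ (U b).1 p = y at *
      generalize k - a.1 = A at *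
      generalize k - b.1 = B at *
      have e4 : k * (y + t) ≤ k * (x + 1) := Nat.mul_le_mul_left _ e3
      have e5 : k * y + B < k * x + A := by nlinarith
      nlinarith
    refine sum_lt_sum (fun p _ => ?_) ⟨β.1, mem_range.2 (by omega), hin _ hαβ le_rfl⟩
    by_cases h1 : α.1 < p
    · by_cases h2 : p ≤ β.1
      · exact (hin p h1 h2).le
      · have e1 := initialSum_transfer (β := β) hα p
        have e2 := initialSum_transfer (β := α) hβ p
        rw [← hr, if_pos h1, if_pos (by omega)] at e1
        rw [← hs, if_pos h1, if_pos (by omega)] at e2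
        rw [add_right_cancel e1, add_right_cancel e2]
    · have e1 := initialSum_transfer (β := β) hα p
      have e2 := initialSum_transfer (β := α) hβ p
      rw [← hr, if_neg h1, if_neg (by omega)] at e1
      rw [← hs, if_neg h1, if_neg (by omega)] at e2
      rw [add_right_cancel e1, add_right_cancel e2]
  unfold sortPotential
  omega

/-- Minimal balanced families with respect to `sortPotential` are sorted. -/
theorem exists_sorted (hℓ : Antitone ℓ) (hG : G = base n ℓ) {S : Set (Fin k → G)}
    (hS : ExchangeClosed S) (hne : S.Nonempty) {σ : Equiv.Perm (Fin n)} {c : Fin n → ℕ}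
    (hc : ∀ p q : Fin n, p ≤ q → c (σ q) ≤ c (σ p))
    (hb : ∀ U ∈ S, ∀ a l, c l ≤ (U a).1 l ∧ (U a).1 l ≤ c l + 1) :
    ∃ U ∈ S, ∀ a b, a < b → ∀ p ≤ n, initialSum σ (U a).1 p ≤ initialSum σ (U b).1 p ∧
      initialSum σ (U b).1 p ≤ initialSum σ (U a).1 p + 1 := by
  subst hG
  obtain ⟨U, hU, hmin⟩ := exists_minimalFor_of_wellFoundedLT (· ∈ S) (sortPotential σ) hne
  have key : ∀ a b, a ≠ b → ∀ t, 1 ≤ t → k + (k - b.1) < k * t + (k - a.1) → ∀ p ≤ n,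
      initialSum σ (U a).1 p < initialSum σ (U b).1 p + t := by
    intro a b hab t ht1 ht p hp
    by_contra! hexc
    obtain ⟨α, β, hαβ, h1, h2, h3, h4, h5⟩ :=
      exists_exchange_of_excess hℓ hc (U a).2 (U b).2 (hb U hU a) (hb U hU b) ht1 hp hexc
    have hmem := hS U hU a b hab _ _ h1 h2 ⟨_, h3⟩ ⟨_, h4⟩ rfl rfl
    have := sortPotential_exchange hab ht hαβ (by omega) (by omega)
      (r := ⟨_, h3⟩) (s := ⟨_, h4⟩) rfl rfl h5
    exact absurd this (not_lt.2 (hmin hmem this.le))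
  refine ⟨U, hU, fun a b hab p hp => ⟨?_, ?_⟩⟩
  · have := key a b hab.ne 1 le_rfl (by omega) p hp
    omega
  · have := key b a hab.ne' 2 (by omega) (by omega) p hp
    omega

theorem eq_of_sum_eq_of_sorted {x y : Fin k → ℕ} (hx : ∀ a b, a < b → x a ≤ x b ∧ x b ≤ x a + 1)
    (hy : ∀ a b, a < b → y a ≤ y b ∧ y b ≤ y a + 1) (h : ∑ a, x a = ∑ a, y a) : x = y := by
  suffices H : ∀ x y : Fin k → ℕ, (∀ a b, a < b → x a ≤ x b ∧ x b ≤ x a + 1) →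
      (∀ a b, a < b → y a ≤ y b ∧ y b ≤ y a + 1) → ∑ a, x a = ∑ a, y a → ∀ a, y a ≤ x a from
    funext fun a => le_antisymm (H y x hy hx h.symm a) (H x y hx hy h a)
  intro x y hx hy h a
  by_contra! hlt
  refine h.not_lt (sum_lt_sum (fun b _ => ?_) ⟨a, mem_univ _, hlt⟩)
  rcases lt_trichotomy a b with hab | rfl | hab
  · have := hx a b hab
    have := hy a b hab
    omega
  · exact hlt.le
  · have := hx b a hab
    have := hy b a hab
    omega

/-- Two nonempty exchange-closed sets of families with the same total have a common element. -/
theorem exists_common_family (hℓ : Antitone ℓ) (hG : G = base n ℓ) {S T : Set (Fin k → G)}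
    (hS : ExchangeClosed S) (hT : ExchangeClosed T) (hSne : S.Nonempty) (hTne : T.Nonempty)
    {w : Fin n →₀ ℕ} (hSw : ∀ U ∈ S, total U = w) (hTw : ∀ U ∈ T, total U = w) :
    ∃ U, U ∈ S ∧ U ∈ T := by
  set c : Fin n → ℕ := fun l => w l / k with hcdef
  set σ := Tuple.sort (fun i => OrderDual.toDual (c i))
  have hc : ∀ p q : Fin n, p ≤ q → c (σ q) ≤ c (σ p) :=
    fun p q h => Tuple.monotone_sort (fun i => OrderDual.toDual (c i)) h
  have key : ∀ S : Set (Fin k → G), ExchangeClosed S → S.Nonempty → (∀ U ∈ S, total U = w) →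
      ∃ U ∈ S, ∀ a b, a < b → ∀ p ≤ n, initialSum σ (U a).1 p ≤ initialSum σ (U b).1 p ∧
        initialSum σ (U b).1 p ≤ initialSum σ (U a).1 p + 1 := by
    intro S hS hne hSw
    obtain ⟨U₀, hU₀, hbal⟩ := exists_balanced hℓ hG hS hne
    have hclosed : ExchangeClosed
        {U | U ∈ S ∧ ∀ a l, c l ≤ (U a).1 l ∧ (U a).1 l ≤ c l + 1} := by
      intro U hU a b hab i j hi hj t w ht hw
      refine ⟨hS U hU.1 a b hab i j hi hj t w ht hw, fun d l => ?_⟩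
      have hij : i ≠ j := by rintro rfl; omega
      have ai := hU.2 a i
      have aj := hU.2 a j
      have bi := hU.2 b i
      have bj := hU.2 b j
      by_cases hdb : d = b
      · rw [hdb, Function.update_self, hw]
        by_cases h1 : l = j
        · rw [h1, transfer_src hij.symm]
          omega
        by_cases h2 : l = i
        · rw [h2, transfer_tgt hij.symm]
          omega
        rw [transfer_of_ne h1 h2]
        exact hU.2 b l
      rw [Function.update_of_ne hdb]
      by_cases hda : d = a
      · rw [hda, Function.update_self, ht]
        by_cases h1 : l = i
        · rw [h1, transfer_src hij]
          omega
        by_cases h2 : l = j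
        · rw [h2, transfer_tgt hij]
          omega
        rw [transfer_of_ne h1 h2]
        exact hU.2 a l
      rw [Function.update_of_ne hda]
      exact hU.2 d l
    obtain ⟨U, hU, h⟩ := exists_sorted hℓ hG hclosed
      ⟨U₀, hU₀, fun a l => by
        have := balanced_bounds hbal a l
        rwa [hSw U₀ hU₀] at this⟩ hc fun U hU => hU.2
    exact ⟨U, hU.1, h⟩
  obtain ⟨U, hU, h1⟩ := key S hS hSne hSw
  obtain ⟨V, hV, h2⟩ := key T hT hTne hTw
  have hsum : ∀ p ≤ n, ∀ a, initialSum σ (U a).1 p = initialSum σ (V a).1 p := by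
    intro p hp
    refine congrFun (eq_of_sum_eq_of_sorted (fun a b hab => h1 a b hab p hp)
      (fun a b hab => h2 a b hab p hp) ?_)
    rw [← initialSum_sum, ← initialSum_sum]
    exact congrArg (fun w => initialSum σ w p) ((hSw U hU).trans (hTw V hV).symm)
  have : U = V := by
    refine funext fun a => Subtype.ext (Finsupp.ext fun i => ?_)
    obtain ⟨p, rfl⟩ := σ.surjective i
    have e1 := hsum (p + 1) p.2 a
    rw [initialSum_succ, initialSum_succ, hsum p p.2.le a] at e1
    exact Nat.add_left_cancel e1
  exact ⟨U, hU, this ▸ hV⟩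

end Exchange
end SymShifted
namespace SymShifted

open Finset

section Rees

variable {n k : ℕ} {ℓ : ℕ → ℕ} {G : Set (Fin n →₀ ℕ)}

theorem exists_isUMax (u : Fin n →₀ ℕ) (i : Fin n) : ∃ m, IsUMax u m := by
  obtain ⟨k, -, hk⟩ := exists_max_image (univ : Finset (Fin n)) u ⟨i, mem_univ _⟩
  have hne : (univ.filter fun k => ∀ l, u l ≤ u k).Nonempty := ⟨k, by simpa using hk⟩
  refine ⟨max' _ hne, (mem_filter.1 (max'_mem _ hne)).2,
    fun j hj => le_max' _ _ (mem_filter.2 ⟨mem_univ _, hj⟩)⟩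

/-- The condition under which moving a unit of `u` from the position `m` of its last maximum to
position `i` decreases `u` with respect to `Prec`. -/
def IsLowering (u : Fin n →₀ ℕ) (i m : Fin n) : Prop :=
  IsUMax u m ∧ (u i + 1 < u m ∨ u i + 1 = u m ∧ i < m)

/-- Sets of pairs of a coefficient and a family which are closed under symmetric exchanges in the
family, and under moving a unit from the coefficient to a member of the family that decreases this
member. -/
structure ReesClosed (S : Set ((Fin n →₀ ℕ) × (Fin k → G))) : Prop where
  exchange : ∀ a, ExchangeClosed {U | (a, U) ∈ S}
  lower : ∀ a U, (a, U) ∈ S → ∀ c i m, 0 < a i → IsLowering (U c).1 i m →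
    ∀ t : G, t.1 = transfer (U c).1 m i → (transfer a i m, Function.update U c t) ∈ S

/-- The potential that is minimized by the normal forms for the Rees algebra. -/
def cellPotential (U : Fin k → G) : ℕ := ∑ c, ∑ l, (n * (U c).1 l ^ 2 + l.1 * (U c).1 l)

theorem cellPotential_exchange {U : Fin k → G} {a b : Fin k} (hab : a ≠ b) {i j : Fin n}
    (hi : (U b).1 i < (U a).1 i) (hj : (U a).1 j < (U b).1 j) {t w : G}
    (ht : t.1 = transfer (U a).1 i j) (hw : w.1 = transfer (U b).1 j i) :
    cellPotential (Function.update (Function.update U a t) b w) ≤ cellPotential U ∧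
      ((U b).1 i + 1 < (U a).1 i →
        cellPotential (Function.update (Function.update U a t) b w) < cellPotential U) := by
  have hij : i ≠ j := by rintro rfl; omega
  have h3 := sum_update_update U hab t w (fun _ u => ∑ l, (n * u.1 l ^ 2 + l.1 * u.1 l))
  have h4 := sum_apply_transfer (u := (U a).1) hij (fun l x => n * x ^ 2 + l.1 * x)
  have h5 := sum_apply_transfer (u := (U b).1) hij.symm (fun l x => n * x ^ 2 + l.1 * x)
  obtain ⟨x, hx⟩ : ∃ x, (U a).1 i = x + 1 := ⟨_, (Nat.sub_add_cancel (by omega)).symm⟩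
  obtain ⟨y, hy⟩ : ∃ y, (U b).1 j = y + 1 := ⟨_, (Nat.sub_add_cancel (by omega)).symm⟩
  have hn : 0 < n := i.pos
  unfold cellPotential
  simp only [ht, hw] at h3
  rw [hx] at h4 hi ⊢
  rw [hy] at h5 hj
  simp only [Nat.add_sub_cancel] at h4 h5
  generalize (U a).1 j = z at *
  generalize (U b).1 i = v at *
  constructor
  · have e1 : n * v ≤ n * x := Nat.mul_le_mul_left _ (by omega)
    have e2 : n * z ≤ n * y := Nat.mul_le_mul_left _ (by omega)
    nlinarith
  · intro hlt
    have e1 : n * (v + 1) ≤ n * x := Nat.mul_le_mul_left _ (by omega)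
    have e2 : n * z ≤ n * y := Nat.mul_le_mul_left _ (by omega)
    nlinarith

theorem cellPotential_lower {U : Fin k → G} {c : Fin k} {i m : Fin n}
    (h : IsLowering (U c).1 i m) {t : G} (ht : t.1 = transfer (U c).1 m i) :
    cellPotential (Function.update U c t) < cellPotential U := by
  have hmi : m ≠ i := by rintro rfl; have := h.2; omega
  have key : ∀ V : Fin k → G, cellPotential V = ∑ l, (n * (V c).1 l ^ 2 + l.1 * (V c).1 l) +
      ∑ d ∈ univ.erase c, ∑ l, (n * (V d).1 l ^ 2 + l.1 * (V d).1 l) :=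
    fun V => (add_sum_erase _ _ (mem_univ c)).symm
  rw [key, key U, Function.update_self]
  have h1 : ∑ d ∈ univ.erase c, ∑ l, (n * (Function.update U c t d).1 l ^ 2 +
      l.1 * (Function.update U c t d).1 l) =
      ∑ d ∈ univ.erase c, ∑ l, (n * (U d).1 l ^ 2 + l.1 * (U d).1 l) := by
    refine sum_congr rfl fun d hd => ?_
    rw [Function.update_of_ne (mem_erase.1 hd).1]
  rw [h1, ht]
  refine Nat.add_lt_add_right ?_ _
  have h4 := sum_apply_transfer (u := (U c).1) hmi (fun l x => n * x ^ 2 + l.1 * x)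
  have h2 := h.2
  obtain ⟨x, hx⟩ : ∃ x, (U c).1 m = x + 1 := ⟨_, (Nat.sub_add_cancel (by omega)).symm⟩
  rw [hx] at h4 h2
  simp only [Nat.add_sub_cancel] at h4
  generalize (U c).1 i = z at *
  have hi := i.2
  rcases h2 with h2 | ⟨h2, h3⟩
  · have e1 : n * (z + 1) ≤ n * x := Nat.mul_le_mul_left _ (by omega)
    nlinarith
  · obtain rfl : z = x := by omega
    have : i.1 < m.1 := h3
    nlinarith

/-- In a state of minimal potential, a unit of a member of the family can only lie below the
lowest free position of every member at which the coefficient is positive. -/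
theorem le_of_minimal (hℓ : Antitone ℓ) (hG : G = base n ℓ)
    {S : Set ((Fin n →₀ ℕ) × (Fin k → G))} (hS : ReesClosed S) {a : Fin n →₀ ℕ} {U : Fin k → G}
    (hU : (a, U) ∈ S) (hmin : ∀ s ∈ S, cellPotential U ≤ cellPotential s.2) (c d : Fin k)
    {i : Fin n} (hi : 0 < a i) (j : Fin n) :
    toLex ((U d).1 j, j) ≤ toLex ((U c).1 i + 1, i) := by
  subst hG
  have sink : ∀ U : Fin k → base n ℓ, (a, U) ∈ S →
      (∀ s ∈ S, cellPotential U ≤ cellPotential s.2) → ∀ c l,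
      toLex ((U c).1 l, l) ≤ toLex ((U c).1 i + 1, i) := by
    intro U hU hmin c l
    by_contra! hlt
    rw [Prod.Lex.toLex_lt_toLex] at hlt
    simp only at hlt
    obtain ⟨m, hm⟩ := exists_isUMax (U c).1 i
    have h1 := hm.1 l
    have hlow : IsLowering (U c).1 i m := by
      refine ⟨hm, ?_⟩
      rcases eq_or_lt_of_le h1 with h1 | h1
      · have : l ≤ m := hm.2 fun p => h1 ▸ hm.1 p
        rcases hlt with h | ⟨h, h'⟩
        · exact Or.inl (h1 ▸ h)
        · exact Or.inr ⟨h.trans h1, h'.trans_le this⟩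
      · left
        omega
    obtain ⟨t, ht⟩ : ∃ t : base n ℓ, t.1 = transfer (U c).1 m i :=
      ⟨⟨_, transfer_mem_base_of_lt (U c).2 (by have := hlow.2; omega)⟩, rfl⟩
    have h2 := hmin _ (hS.lower a U hU c i m hi hlow t ht)
    exact absurd (cellPotential_lower hlow ht) (not_lt.2 h2)
  by_cases hle : (U d).1 j ≤ (U c).1 j
  · refine le_trans ?_ (sink U hU hmin c j)
    rw [Prod.Lex.toLex_le_toLex]
    simp only [le_refl, and_true]
    exact lt_or_eq_of_le hle
  · push Not at hle
    have hdc : d ≠ c := by rintro rfl; omega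
    obtain ⟨p, hp, h1, h2⟩ := base_exchange hℓ (U d).2 (U c).2 hle
    have hjp : p ≠ j := by rintro rfl; omega
    obtain ⟨t, ht⟩ : ∃ t : base n ℓ, t.1 = transfer (U d).1 j p := ⟨⟨_, h1⟩, rfl⟩
    obtain ⟨w, hw⟩ : ∃ w : base n ℓ, w.1 = transfer (U c).1 p j := ⟨⟨_, h2⟩, rfl⟩
    have hmem : (a, Function.update (Function.update U d t) c w) ∈ S :=
      hS.exchange a U hU d c hdc j p hle hp t w ht hw
    have hmin' := hmin _ hmem
    have hpot := cellPotential_exchange hdc hle hp ht hw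
    have hbal : (U d).1 j = (U c).1 j + 1 := by
      by_contra hne
      exact absurd (hpot.2 (by omega)) (not_lt.2 hmin')
    by_cases hij : j = i
    · rw [hbal, hij]
    have := sink _ hmem (fun s hs => hpot.1.trans (hmin s hs)) c j
    rw [Function.update_self, hw, transfer_tgt hjp] at this
    rw [hbal]
    refine this.trans ?_
    rw [Prod.Lex.toLex_le_toLex]
    simp only [le_refl, and_true]
    by_cases hip : i = p
    · rw [hip, transfer_src hjp]
      omega
    · right
      rw [transfer_of_ne hip (Ne.symm hij)]

/-- Two nonempty closed sets of states with the same product contain states with the same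
coefficient. -/
theorem exists_common_coefficient (hℓ : Antitone ℓ) (hG : G = base n ℓ)
    {S T : Set ((Fin n →₀ ℕ) × (Fin k → G))} (hS : ReesClosed S) (hT : ReesClosed T)
    (hSne : S.Nonempty) (hTne : T.Nonempty) {w : Fin n →₀ ℕ}
    (hSw : ∀ s ∈ S, s.1 + total s.2 = w) (hTw : ∀ s ∈ T, s.1 + total s.2 = w) :
    ∃ a U V, (a, U) ∈ S ∧ (a, V) ∈ T := by
  obtain ⟨⟨a, U⟩, hU, hUmin⟩ := exists_minimalFor_of_wellFoundedLT (· ∈ S)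
    (fun s => cellPotential s.2) hSne
  obtain ⟨⟨a', V⟩, hV, hVmin⟩ := exists_minimalFor_of_wellFoundedLT (· ∈ T)
    (fun s => cellPotential s.2) hTne
  have hUmin' : ∀ s ∈ S, cellPotential U ≤ cellPotential s.2 := fun s hs =>
    (le_total _ _).elim id fun h => hUmin hs h
  have hVmin' : ∀ s ∈ T, cellPotential V ≤ cellPotential s.2 := fun s hs =>
    (le_total _ _).elim id fun h => hVmin hs h
  have hUle := le_of_minimal hℓ hG hS hU hUmin'
  have hVle := le_of_minimal hℓ hG hT hV hVmin'
  have hUw : a + total U = w := hSw _ hU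
  have hVw : a' + total V = w := hTw _ hV
  suffices h : a = a' from ⟨a, U, V, hU, h ▸ hV⟩
  clear hSw hTw hSne hTne hUmin hVmin hUmin' hVmin' hU hV hS hT
  have hdeg : ∀ U : Fin k → G, (total U).degree = k * prefixSum ℓ n := by
    intro U
    rw [total, map_sum, sum_congr rfl fun c _ => (hG ▸ (U c).2 : (U c).1 ∈ base n ℓ).1]
    simp
  have hdega : a.degree = a'.degree := by
    have h1 := congrArg Finsupp.degree (hUw.trans hVw.symm)
    rw [map_add, map_add, hdeg, hdeg] at h1
    exact Nat.add_right_cancel h1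
  have hsum : ∀ l, a l + total U l = a' l + total V l := fun l => by
    have := congrArg (fun f => f l) (hUw.trans hVw.symm)
    simpa using this
  have eq_of_le : ∀ x y : Fin n →₀ ℕ, x.degree = y.degree → ∀ i, (∀ l, l ≠ i → x l ≤ y l) →
      (∀ l, l ≠ i → y l ≤ x l) → x = y := by
    intro x y hxy i h1 h2
    ext l
    have hne : ∀ l, l ≠ i → x l = y l := fun l hl => le_antisymm (h1 l hl) (h2 l hl)
    by_cases hl : l = i
    · subst hl
      rw [Finsupp.degree_eq_sum, Finsupp.degree_eq_sum, ← add_sum_erase _ _ (mem_univ l),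
        ← add_sum_erase univ y (mem_univ l),
        sum_congr (g := y) rfl fun j hj => hne j (mem_erase.1 hj).1] at hxy
      exact Nat.add_right_cancel hxy
    · exact hne l hl
  have eq_of_forall_le : ∀ x y : Fin n →₀ ℕ, x.degree = y.degree → x ≤ y → x = y := by
    intro x y hxy hle
    obtain ⟨z, rfl⟩ := exists_add_of_le hle
    rw [map_add, left_eq_add, Finsupp.degree_eq_zero_iff] at hxy
    rw [hxy, add_zero]
  rcases Nat.eq_zero_or_pos k with rfl | hk
  · have h0 : ∀ U : Fin 0 → G, total U = 0 := fun U => by simp [total]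
    rw [h0, add_zero] at hUw hVw
    exact hUw.trans hVw.symm
  by_cases ha : a = 0
  · rw [ha] at hdega ⊢
    rw [map_zero, eq_comm, Finsupp.degree_eq_zero_iff] at hdega
    exact hdega.symm
  have ha' : a' ≠ 0 := by
    rintro rfl
    rw [map_zero, Finsupp.degree_eq_zero_iff] at hdega
    exact ha hdega

  have cell : ∀ (a : Fin n →₀ ℕ) (U : Fin k → G), a ≠ 0 →
      (∀ (c d : Fin k) {i : Fin n}, 0 < a i → ∀ j,
        toLex ((U d).1 j, j) ≤ toLex ((U c).1 i + 1, i)) →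
      ∃ e : ℕ ×ₗ Fin n, (∀ c j, toLex ((U c).1 j, j) ≤ e) ∧
        ∀ c i, 0 < a i → e ≤ toLex ((U c).1 i + 1, i) := by
    intro a U ha h
    obtain ⟨i, hi⟩ := Finsupp.ne_iff.1 ha
    have hi' : 0 < a i := Nat.pos_of_ne_zero hi
    obtain ⟨p, hp, hpmin⟩ := exists_min_image
      ((univ : Finset (Fin k)) ×ˢ univ.filter fun i => 0 < a i)
      (fun p => toLex ((U p.1).1 p.2 + 1, p.2)) ⟨(⟨0, hk⟩, i), by simp [hi']⟩
    simp only [mem_product, mem_univ, true_and, mem_filter] at hp hpmin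
    exact ⟨_, fun c j => h p.1 c hp j, fun c i hi => hpmin (c, i) hi⟩
  obtain ⟨e, h1, h2⟩ := cell a U ha hUle
  obtain ⟨e', h1', h2'⟩ := cell a' V ha' hVle
  have comp : ∀ (a a' : Fin n →₀ ℕ) (U V : Fin k → G) (e e' : ℕ ×ₗ Fin n),
      (∀ l, a l + total U l = a' l + total V l) → (∀ c j, toLex ((U c).1 j, j) ≤ e) →
      (∀ c i, 0 < a' i → e' ≤ toLex ((V c).1 i + 1, i)) → e ≤ e' → ∀ l,
      (e < e' ∨ l ≠ (ofLex e).2) → a' l ≤ a l := by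
    intro a a' U V e e' hsum h1 h2 hee l hl
    rcases Nat.eq_zero_or_pos (a' l) with h0 | h0
    · omega
    have hle : total U l ≤ total V l := by
      rw [total_apply, total_apply]
      refine sum_le_sum fun c _ => ?_
      have h3 : toLex ((U c).1 l, l) < toLex ((V c).1 l + 1, l) := by
        rcases hl with hl | hl
        · exact (h1 c l).trans_lt (hl.trans_le (h2 c l h0))
        · refine lt_of_le_of_ne ((h1 c l).trans (hee.trans (h2 c l h0))) fun heq => hl ?_
          have : toLex ((U c).1 l, l) = e :=
            le_antisymm (h1 c l) (heq ▸ hee.trans (h2 c l h0))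
          rw [← this]
          rfl
      rw [Prod.Lex.toLex_lt_toLex] at h3
      simp only [lt_irrefl, and_false, or_false] at h3
      omega
    have := hsum l
    omega
  rcases lt_trichotomy e e' with h | h | h
  · exact (eq_of_forall_le a' a hdega.symm fun l =>
      comp a a' U V e e' hsum h1 h2' h.le l (Or.inl h)).symm
  · subst h
    exact eq_of_le a a' hdega (ofLex e).2
      (fun l hl => comp a' a V U e e (fun l => (hsum l).symm) h1' h2 le_rfl l (Or.inr hl))
      (fun l hl => comp a a' U V e e hsum h1 h2' le_rfl l (Or.inr hl))
  · exact eq_of_forall_le a a' hdega fun l =>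
      comp a' a V U e' e (fun l => (hsum l).symm) h1' h2 h.le l (Or.inl h)

end Rees

end SymShifted
namespace SymShifted

open MvPolynomial

theorem ker_le_of_basis {K A B ι κ : Type*} [Field K] [AddCommGroup A] [Module K A]
    [AddCommGroup B] [Module K B] (b : Module.Basis ι K A) (b' : Module.Basis κ K B)
    (φ : A →ₗ[K] B) (π : ι → κ) (hφ : ∀ i, φ (b i) = b' (π i)) (E : Submodule K A)
    (h : ∀ i j, π i = π j → b i - b j ∈ E) : LinearMap.ker φ ≤ E := by
  classical
  set L : B →ₗ[K] A ⧸ E :=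
    b'.constr K fun x => if h : ∃ i, π i = x then E.mkQ (b h.choose) else 0 with hL
  have hcomp : L ∘ₗ φ = E.mkQ := by
    refine b.ext fun i => ?_
    have hi : ∃ j, π j = π i := ⟨i, rfl⟩
    rw [LinearMap.comp_apply, hφ, hL, Module.Basis.constr_basis, dif_pos hi]
    exact (Submodule.Quotient.eq E).2 (h _ _ hi.choose_spec)
  intro x hx
  have h1 := congrArg (fun f : A →ₗ[K] A ⧸ E => f x) hcomp
  rw [LinearMap.mem_ker] at hx
  simp only [LinearMap.comp_apply, hx, map_zero] at h1
  rwa [eq_comm, Submodule.mkQ_apply, Submodule.Quotient.mk_eq_zero] at h1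

theorem exists_family {G R : Type*} [CommSemiring R] (m : G →₀ ℕ) :
    ∃ (k : ℕ) (U : Fin k → G), monomial m (1 : R) = ∏ c, X (U c) := by
  induction m using Finsupp.induction_linear with
  | zero => exact ⟨0, Fin.elim0, by simp⟩
  | add f g hf hg =>
    obtain ⟨k, U, hU⟩ := hf
    obtain ⟨k', V, hV⟩ := hg
    refine ⟨k + k', Fin.append U V, ?_⟩
    rw [Fin.prod_univ_add]
    simp only [Fin.append_left, Fin.append_right]
    rw [← hU, ← hV, monomial_mul, one_mul]
  | single u e => exact ⟨e, fun _ => u, by simp [X_pow_eq_monomial]⟩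

theorem exists_prod_update_update {ι α M : Type*} [Fintype ι] [DecidableEq ι] [CommMonoid M]
    (U : ι → α) {a b : ι} (hab : a ≠ b) (x y : α) (g : α → M) :
    ∃ q, ∏ c, g (U c) = g (U a) * g (U b) * q ∧
      ∏ c, g (Function.update (Function.update U a x) b y c) = g x * g y * q := by
  refine ⟨∏ c ∈ (Finset.univ.erase a).erase b, g (U c), ?_, ?_⟩
  · rw [← Finset.mul_prod_erase _ _ (Finset.mem_univ a),
      ← Finset.mul_prod_erase (Finset.univ.erase a) _ (a := b) (by simp [hab.symm]), mul_assoc]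
  · rw [← Finset.mul_prod_erase _ _ (Finset.mem_univ a),
      ← Finset.mul_prod_erase (Finset.univ.erase a) _ (a := b) (by simp [hab.symm]),
      Function.update_self, Function.update_of_ne hab, Function.update_self, mul_assoc]
    congr 2
    refine Finset.prod_congr rfl fun c hc => ?_
    simp only [Finset.mem_erase] at hc
    rw [Function.update_of_ne hc.1, Function.update_of_ne hc.2.1]

theorem exists_prod_update {ι α M : Type*} [Fintype ι] [DecidableEq ι] [CommMonoid M]
    (U : ι → α) (a : ι) (x : α) (g : α → M) :
    ∃ q, ∏ c, g (U c) = g (U a) * q ∧ ∏ c, g (Function.update U a x c) = g x * q := by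
  refine ⟨∏ c ∈ Finset.univ.erase a, g (U c), ?_, ?_⟩
  · rw [← Finset.mul_prod_erase _ _ (Finset.mem_univ a)]
  · rw [← Finset.mul_prod_erase _ _ (Finset.mem_univ a), Function.update_self]
    congr 1
    refine Finset.prod_congr rfl fun c hc => ?_
    rw [Function.update_of_ne (Finset.mem_erase.1 hc).1]

/-- Ideals of `R[T_u : u ∈ G]` which contain the symmetric exchange relations. -/
def HasExchange {n : ℕ} {G : Set (Fin n →₀ ℕ)} {R : Type*} [CommRing R]
    (J : Ideal (MvPolynomial G R)) : Prop :=
  ∀ (r s t w : G) (i j : Fin n), s.1 i < r.1 i → r.1 j < s.1 j → t.1 = transfer r.1 i j →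
    w.1 = transfer s.1 j i → (X r * X s - X t * X w : MvPolynomial G R) ∈ J

section

variable {n k : ℕ} {ℓ : ℕ → ℕ} {G : Set (Fin n →₀ ℕ)} {R : Type*} [CommRing R]
  {J : Ideal (MvPolynomial G R)}

theorem HasExchange.prod_sub_mem (hJ : HasExchange J) {U : Fin k → G} {a b : Fin k} (hab : a ≠ b)
    {i j : Fin n} (hi : (U b).1 i < (U a).1 i) (hj : (U a).1 j < (U b).1 j) {t w : G}
    (ht : t.1 = transfer (U a).1 i j) (hw : w.1 = transfer (U b).1 j i) :
    (∏ c, X (U c) - ∏ c, X (Function.update (Function.update U a t) b w c) :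
      MvPolynomial G R) ∈ J := by
  obtain ⟨q, h1, h2⟩ := exists_prod_update_update U hab t w
    (X : G → MvPolynomial G R)
  rw [h1, h2, ← sub_mul]
  exact J.mul_mem_right q (hJ _ _ _ _ i j hi hj ht hw)

theorem HasExchange.prod_sub_prod_mem (hJ : HasExchange J) (hℓ : Antitone ℓ) (hG : G = base n ℓ)
    {U V : Fin k → G} (h : total U = total V) :
    (∏ c, X (U c) - ∏ c, X (V c) : MvPolynomial G R) ∈ J := by
  have key : ∀ U : Fin k → G, ExchangeClosed {W : Fin k → G | total W = total U ∧
      (∏ c, X (U c) - ∏ c, X (W c) : MvPolynomial G R) ∈ J} := by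
    intro U W hW a b hab i j hi hj t w ht hw
    refine ⟨(total_exchange hab (by omega) (by omega) ht hw).trans hW.1, ?_⟩
    have := J.add_mem hW.2 (hJ.prod_sub_mem hab hi hj ht hw)
    rwa [sub_add_sub_cancel] at this
  obtain ⟨W, h1, h2⟩ := exists_common_family hℓ hG (key U) (key V)
    ⟨U, rfl, by simp⟩ ⟨V, rfl, by simp⟩ (fun W hW => hW.1) (fun W hW => hW.1.trans h.symm)
  have := J.sub_mem h1.2 h2.2
  rwa [sub_sub_sub_cancel_right] at this

theorem degree_total (hG : G = base n ℓ) (U : Fin k → G) :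
    (total U).degree = k * prefixSum ℓ n := by
  rw [total, map_sum,
    Finset.sum_congr rfl fun c _ => (hG ▸ (U c).2 : (U c).1 ∈ base n ℓ).1]
  simp

end

section Toric

variable {K : Type*} [Field K] {n : ℕ} {I : Ideal (MvPolynomial (Fin n) K)} {ℓ : ℕ → ℕ}

theorem mon_add (a b : Fin n →₀ ℕ) : mon K (a + b) = mon K a * mon K b := by
  simp [mon, monomial_mul]

theorem mon_single (i : Fin n) : mon K (Finsupp.single i 1) = X i := rfl

theorem prod_mon {k : ℕ} {G : Set (Fin n →₀ ℕ)} (U : Fin k → G) :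
    ∏ c, mon K (U c).1 = mon K (total U) :=
  (monomial_sum_one _ _).symm

theorem hasExchange_span (I : Ideal (MvPolynomial (Fin n) K)) :
    HasExchange (Ideal.span (exchangeRelations I)) := by
  intro r s t w i j hi hj ht hw
  refine Ideal.subset_span ⟨r, s, t, w, i, j, hi, hj, ?_, ?_, rfl⟩
  · rw [ht, transfer_add_single j (by omega)]
  · rw [hw, transfer_add_single i (by omega)]

theorem exchange_add_eq {r s t w : Fin n →₀ ℕ} {i j : Fin n}
    (h1 : t + Finsupp.single i 1 = r + Finsupp.single j 1)
    (h2 : w + Finsupp.single j 1 = s + Finsupp.single i 1) : t + w = r + s := by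
  apply add_right_cancel (b := Finsupp.single i 1 + Finsupp.single j 1)
  calc _ = (t + Finsupp.single i 1) + (w + Finsupp.single j 1) := by abel
    _ = _ := by rw [h1, h2]; abel

theorem span_exchangeRelations_le (I : Ideal (MvPolynomial (Fin n) K)) :
    Ideal.span (exchangeRelations I) ≤ toricIdeal I := by
  rw [Ideal.span_le]
  rintro f ⟨r, s, t, w, i, j, -, -, h1, h2, rfl⟩
  change aeval (fun u : gens I => mon K u.1) _ = 0
  simp [← mon_add, exchange_add_eq h1 h2]

theorem toricIdeal_eq (hℓ : Antitone ℓ) (hG : gens I = base n ℓ) (hd : 0 < prefixSum ℓ n) :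
    toricIdeal I = Ideal.span (exchangeRelations I) := by
  refine le_antisymm ?_ (span_exchangeRelations_le I)
  choose k U hU using exists_family (G := gens I) (R := K)
  refine ker_le_of_basis (basisMonomials (gens I) K) (basisMonomials (Fin n) K)
    (aeval (fun u : gens I => mon K u.1)).toLinearMap (fun m => total (U m)) (fun m => ?_)
    ((Ideal.span (exchangeRelations I)).restrictScalars K) (fun m m' h => ?_)
  · simp only [coe_basisMonomials, AlgHom.toLinearMap_apply]
    rw [hU, map_prod]
    simp only [aeval_X]
    exact prod_mon _
  · simp only [coe_basisMonomials, Submodule.restrictScalars_mem]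
    rw [hU m, hU m']
    have hk : k m = k m' := by
      have := congrArg Finsupp.degree h
      rw [degree_total hG, degree_total hG] at this
      exact Nat.eq_of_mul_eq_mul_right hd this
    generalize U m = V at *
    generalize U m' = V' at *
    generalize k m = p at *
    subst hk
    exact (hasExchange_span I).prod_sub_prod_mem hℓ hG h

end Toric
end SymShifted
namespace SymShifted

open MvPolynomial

section Order

variable {n : ℕ}

theorem part_le_iff (u : Fin n →₀ ℕ) (p : Fin n) (a : ℕ) :
    part u p ≤ a ↔ p.1 < (Finset.univ.filter fun i => u i ≤ a).card := by
  have h : Monotone (part u) := Tuple.monotone_sort u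
  rw [← Tuple.lt_card_le_iff_apply_le_of_monotone h,
    Finset.card_equiv (s := Finset.univ.filter fun i => part u i ≤ a)
      (t := Finset.univ.filter fun i => u i ≤ a) (Tuple.sort u)
      fun i => by simp only [Finset.mem_filter, Finset.mem_univ, true_and]; rfl]

theorem sum_part (u : Fin n →₀ ℕ) : ∑ i, part u i = u.degree := by
  rw [Finsupp.degree_eq_sum]
  exact Equiv.sum_comp (Tuple.sort u) u

theorem prec_transfer {u : Fin n →₀ ℕ} {i m : Fin n} (h : IsLowering u i m) :
    Prec (transfer u m i) u := by
  have hmi : m ≠ i := by rintro rfl; have := h.2; omega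
  have hm0 : 0 < u m := by have := h.2; omega
  have hdeg := degree_transfer i hm0
  set v := transfer u m i with hv
  have hvm : v m = u m - 1 := transfer_src hmi
  have hvi : v i = u i + 1 := transfer_tgt hmi
  have hvl : ∀ l, l ≠ m → l ≠ i → v l = u l := fun l => transfer_of_ne
  rcases h.2 with h1 | ⟨h1, h2⟩
  · left
    refine Or.inr ⟨by rw [sum_part, sum_part, hdeg], ?_⟩
    have hlt : ∀ x < u i, (Finset.univ.filter fun l => v l ≤ x) =
        Finset.univ.filter fun l => u l ≤ x := by
      intro x hx
      refine Finset.filter_congr fun l _ => ?_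
      by_cases e1 : l = m
      · subst e1; omega
      by_cases e2 : l = i
      · subst e2; omega
      rw [hvl l e1 e2]
    have hins : (Finset.univ.filter fun l => u l ≤ u i) =
        insert i (Finset.univ.filter fun l => v l ≤ u i) := by
      ext l
      simp only [Finset.mem_filter, Finset.mem_univ, true_and, Finset.mem_insert]
      by_cases e2 : l = i
      · simp [e2]
      by_cases e1 : l = m
      · subst e1; omega
      rw [hvl l e1 e2]
      simp [e2]
    have hcard := congrArg Finset.card hins
    rw [Finset.card_insert_of_notMem (by simp [hvi])] at hcard
    have hle := Finset.card_le_univ (Finset.univ.filter fun l => u l ≤ u i)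
    rw [Fintype.card_fin] at hle
    have key : ∀ p : Fin n, p.1 < (Finset.univ.filter fun l => v l ≤ u i).card →
        part v p = part u p := by
      intro p hp
      have h3 : part v p ≤ u i := (part_le_iff v p _).2 hp
      have h4 : part u p ≤ u i := (part_le_iff u p _).2 (by omega)
      refine eq_of_forall_ge_iff fun x => ?_
      rcases lt_or_ge x (u i) with hx | hx
      · rw [part_le_iff, part_le_iff, hlt x hx]
      · exact iff_of_true (h3.trans hx) (h4.trans hx)
    refine ⟨⟨(Finset.univ.filter fun l => v l ≤ u i).card, by omega⟩, fun p hp => key p hp, ?_⟩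
    refine lt_of_le_of_lt ((part_le_iff u _ (u i)).2 (by simp; omega)) ?_
    rw [← not_le, part_le_iff]
    exact lt_irrefl _
  · right
    refine ⟨funext fun p => eq_of_forall_ge_iff fun x => ?_, Or.inr ⟨?_, i, fun l hl => ?_, ?_⟩⟩
    · rw [part_le_iff, part_le_iff, Finset.card_equiv (Equiv.swap i m)]
      intro l
      simp only [Finset.mem_filter, Finset.mem_univ, true_and]
      by_cases e1 : l = m
      · subst e1
        rw [Equiv.swap_apply_right]
        omega
      by_cases e2 : l = i
      · subst e2
        rw [Equiv.swap_apply_left]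
        omega
      rw [Equiv.swap_apply_of_ne_of_ne e2 e1, hvl l e1 e2]
    · rw [← Finsupp.degree_eq_sum, ← Finsupp.degree_eq_sum, hdeg]
    · exact hvl l (hl.trans h2).ne hl.ne
    · omega

end Order

section Rees

variable {K : Type*} [Field K] {n : ℕ} {I : Ideal (MvPolynomial (Fin n) K)} {ℓ : ℕ → ℕ}

theorem coe_reesMap_prod {k : ℕ} (U : Fin k → gens I) :
    (reesMap I (∏ c, X (U c))).1 = Polynomial.monomial k (mon K (total U)) := by
  rw [map_prod, ← prod_mon]
  simp only [reesMap, aeval_X]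
  change (reesAlgebra I).val _ = _
  rw [map_prod]
  change ∏ c, Polynomial.monomial 1 (mon K (U c).1) = _
  simp only [← Polynomial.C_mul_X_pow_eq_monomial, Finset.prod_mul_distrib, pow_one, map_prod]
  simp

theorem mem_reesIdeal {f : MvPolynomial (gens I) (MvPolynomial (Fin n) K)} :
    f ∈ reesIdeal I ↔ (reesMap I f).1 = 0 := by
  rw [reesIdeal, RingHom.mem_ker]
  exact ZeroMemClass.coe_eq_zero.symm

theorem coe_reesMap_X (u : gens I) :
    (reesMap I (X u)).1 = Polynomial.monomial 1 (mon K u.1) := by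
  simp [reesMap, reesGen]

theorem coe_reesMap_C (a : MvPolynomial (Fin n) K) :
    (reesMap I (C a)).1 = Polynomial.C a := by
  simp only [reesMap, algHom_C]
  rfl

/-- The proposed generators of the defining ideal of the Rees algebra. -/
noncomputable def reesRelations (I : Ideal (MvPolynomial (Fin n) K)) :
    Ideal (MvPolynomial (gens I) (MvPolynomial (Fin n) K)) :=
  Ideal.span (MvPolynomial.map MvPolynomial.C '' exchangeRelations I ∪ syzygyRelations I)

theorem hasExchange_reesRelations (I : Ideal (MvPolynomial (Fin n) K)) :
    HasExchange (reesRelations I) := by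
  intro r s t w i j hi hj ht hw
  refine Ideal.subset_span (Or.inl ⟨X r * X s - X t * X w,
    ⟨r, s, t, w, i, j, hi, hj, ?_, ?_, rfl⟩, by simp⟩)
  · rw [ht, transfer_add_single j (by omega)]
  · rw [hw, transfer_add_single i (by omega)]

theorem lowering_mem_reesRelations {u v : gens I} {i m : Fin n} (h : IsLowering u.1 i m)
    (hv : v.1 = transfer u.1 m i) :
    (C (X i) * X u - C (X m) * X v : MvPolynomial (gens I) (MvPolynomial (Fin n) K)) ∈
      reesRelations I := by
  have h0 : 0 < u.1 m := by have := h.2; omega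
  have hp : Prec v.1 u.1 := hv ▸ prec_transfer h
  have heq : u.1 + Finsupp.single i 1 = v.1 + Finsupp.single m 1 := by
    rw [hv, transfer_add_single i h0]
  refine Ideal.subset_span (Or.inr ⟨u, v, i, m, h.1, hp, ?_, heq, rfl⟩)
  rw [colonIdeal, Submodule.mem_colon_singleton, smul_eq_mul, ← mon_single, ← mon_add, add_comm,
    heq, mon_add]
  exact Ideal.mul_mem_right _ _ (Ideal.subset_span ⟨v.1, ⟨v.2, hp⟩, rfl⟩)

theorem reesRelations_le (I : Ideal (MvPolynomial (Fin n) K)) :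
    reesRelations I ≤ reesIdeal I := by
  rw [reesRelations, Ideal.span_le]
  rintro f (⟨f, ⟨r, s, t, w, i, j, -, -, h1, h2, rfl⟩, rfl⟩ | ⟨u, v, i, m, -, -, -, h, rfl⟩)
  · rw [SetLike.mem_coe, mem_reesIdeal]
    simp only [map_sub, map_mul, map_X, AddSubgroupClass.coe_sub, MulMemClass.coe_mul,
      coe_reesMap_X, Polynomial.monomial_mul_monomial, ← mon_add, exchange_add_eq h1 h2, sub_self]
  · rw [SetLike.mem_coe, mem_reesIdeal]
    simp only [map_sub, map_mul, AddSubgroupClass.coe_sub, MulMemClass.coe_mul,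
      coe_reesMap_X, coe_reesMap_C, Polynomial.C_mul_monomial, ← mon_single, ← mon_add]
    rw [add_comm, h, add_comm, sub_self]

theorem state_sub_mem (hℓ : Antitone ℓ) (hG : gens I = base n ℓ) {k : ℕ} {a b : Fin n →₀ ℕ}
    {U V : Fin k → gens I} (h : a + total U = b + total V) :
    (C (mon K a) * ∏ c, X (U c) - C (mon K b) * ∏ c, X (V c) :
      MvPolynomial (gens I) (MvPolynomial (Fin n) K)) ∈ reesRelations I := by
  have key : ∀ (a : Fin n →₀ ℕ) (U : Fin k → gens I), ReesClosed
      {s : (Fin n →₀ ℕ) × (Fin k → gens I) | s.1 + total s.2 = a + total U ∧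
        (C (mon K a) * ∏ c, X (U c) - C (mon K s.1) * ∏ c, X (s.2 c) :
          MvPolynomial (gens I) (MvPolynomial (Fin n) K)) ∈ reesRelations I} := by
    intro a U
    refine ⟨fun b W hW c d hcd i j hi hj t w ht hw => ⟨?_, ?_⟩,
      fun b W hW c i m hi hlow t ht => ⟨?_, ?_⟩⟩
    · rw [← hW.1]
      exact congrArg (b + ·) (total_exchange hcd (by omega) (by omega) ht hw)
    · have := (reesRelations I).add_mem hW.2 ((reesRelations I).mul_mem_left (C (mon K b))
        ((hasExchange_reesRelations I).prod_sub_mem hcd hi hj ht hw))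
      rwa [mul_sub, sub_add_sub_cancel] at this
    · have h0 : 0 < (W c).1 m := by have := hlow.2; omega
      have h1 := transfer_add_single m hi
      have h2 := transfer_add_single i h0
      have h3 : total (Function.update W c t) + (W c).1 = total W + t.1 := by
        have h4 : ∀ W : Fin k → gens I, total W = (W c).1 +
            ∑ d ∈ Finset.univ.erase c, (W d).1 :=
          fun W => (Finset.add_sum_erase _ _ (Finset.mem_univ c)).symm
        rw [h4, h4 W, Function.update_self, Finset.sum_congr rfl fun d hd => by
          rw [Function.update_of_ne (Finset.mem_erase.1 hd).1]]
        abel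
      rw [← hW.1]
      apply add_right_cancel (b := Finsupp.single i 1 + Finsupp.single m 1 + (W c).1)
      calc _ = (transfer b i m + Finsupp.single i 1) +
            (total (Function.update W c t) + (W c).1) + Finsupp.single m 1 := by
              simp only; abel
        _ = (b + Finsupp.single m 1) + total W + (t.1 + Finsupp.single m 1) := by
              rw [h1, h3]; abel
        _ = _ := by rw [ht, h2]; simp only; abel
    · obtain ⟨q, h1, h2⟩ := exists_prod_update W c t
        (X : gens I → MvPolynomial (gens I) (MvPolynomial (Fin n) K))
      obtain ⟨b', hb'⟩ : ∃ b', b = b' + Finsupp.single i 1 :=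
        ⟨b - Finsupp.single i 1, (tsub_add_cancel_of_le (by
          simpa [Nat.one_le_iff_ne_zero, Nat.pos_iff_ne_zero] using hi)).symm⟩
      have h3 : transfer b i m = b' + Finsupp.single m 1 := by
        apply add_right_cancel (b := Finsupp.single i 1)
        rw [transfer_add_single m hi, hb']
        abel
      have h4 := (reesRelations I).mul_mem_left (C (mon K b') * q)
        (lowering_mem_reesRelations hlow ht)
      have h5 := (reesRelations I).add_mem hW.2 h4
      simp only at h5 ⊢
      rw [h1, hb', mon_add, mon_single, C_mul] at h5
      rw [h2, h3, mon_add, mon_single, C_mul]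
      convert h5 using 1
      ring
  obtain ⟨c, W, W', h1, h2⟩ := exists_common_coefficient hℓ hG (key a U) (key b V)
    ⟨(a, U), rfl, by simp⟩ ⟨(b, V), rfl, by simp⟩ (fun s hs => hs.1)
    (fun s hs => hs.1.trans h.symm)
  have h3 : total W = total W' := add_left_cancel (h1.1.trans (h.trans h2.1.symm))
  have h4 := (reesRelations I).mul_mem_left (C (mon K c))
    ((hasExchange_reesRelations I).prod_sub_prod_mem hℓ hG h3)
  have h5 := (reesRelations I).sub_mem ((reesRelations I).add_mem h1.2 h4) h2.2
  convert h5 using 1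
  simp only
  ring

theorem reesIdeal_eq (hℓ : Antitone ℓ) (hG : gens I = base n ℓ) :
    reesIdeal I = reesRelations I := by
  refine le_antisymm (fun f hf => ?_) (reesRelations_le I)
  choose k U hU using exists_family (G := gens I) (R := MvPolynomial (Fin n) K)
  refine ker_le_of_basis
    ((basisMonomials (Fin n) K).smulTower (basisMonomials (gens I) (MvPolynomial (Fin n) K)))
    ((basisMonomials (Fin n) K).smulTower (Polynomial.basisMonomials (MvPolynomial (Fin n) K)))
    (((reesAlgebra I).val.comp (reesMap I)).toLinearMap.restrictScalars K)
    (fun p => (p.1 + total (U p.2), k p.2)) (fun p => ?_)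
    ((reesRelations I).restrictScalars K) (fun p q h => ?_) (mem_reesIdeal.1 hf)
  · rw [Module.Basis.smulTower_apply, Module.Basis.smulTower_apply]
    simp only [coe_basisMonomials, Polynomial.coe_basisMonomials, LinearMap.coe_restrictScalars,
      AlgHom.toLinearMap_apply, map_smul]
    rw [hU]
    change mon K p.1 • (reesMap I (∏ c, X (U p.2 c))).1 = mon K (p.1 + total (U p.2)) • _
    rw [coe_reesMap_prod, Polynomial.smul_monomial, Polynomial.smul_monomial, mon_add]
    simp
  · rw [Module.Basis.smulTower_apply, Module.Basis.smulTower_apply]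
    simp only [coe_basisMonomials, Submodule.restrictScalars_mem, smul_eq_C_mul]
    rw [hU p.2, hU q.2]
    simp only [Prod.mk.injEq] at h
    obtain ⟨h, hk⟩ := h
    generalize U p.2 = V at *
    generalize U q.2 = V' at *
    generalize k p.2 = p' at *
    subst hk
    exact state_sub_mem hℓ hG h

end Rees

section Fiber

variable {K : Type*} [Field K] {n : ℕ} {I : Ideal (MvPolynomial (Fin n) K)} {ℓ : ℕ → ℕ}

theorem exists_gens_le {a : Fin n →₀ ℕ} (ha : mon K a ∈ I) : ∃ u ∈ gens I, u ≤ a := by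
  obtain ⟨u, hu, hmin⟩ := exists_minimal_le_of_wellFoundedLT (fun b => mon K b ∈ I) a ha
  exact ⟨u, hmin, hu⟩

theorem le_pow_idealOfVars (hI : IsMonomialIdeal I) {d : ℕ} (hd : ∀ u ∈ gens I, u.degree = d) :
    I ≤ idealOfVars (Fin n) K ^ d := by
  obtain ⟨A, hA⟩ := hI
  have : ∀ a ∈ A, mon K a ∈ I := fun a ha => hA ▸ Ideal.subset_span ⟨a, ha, rfl⟩
  nth_rewrite 1 [hA]
  rw [Ideal.span_le]
  rintro _ ⟨a, ha, rfl⟩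
  obtain ⟨u, hu, hle⟩ := exists_gens_le (this a ha)
  rw [SetLike.mem_coe, mon, monomial_mem_pow_idealOfVars_iff _ _ one_ne_zero, ← hd u hu]
  exact Finsupp.degree_mono hle

theorem coeff_mem_of_mem_map (hI : IsMonomialIdeal I) {d : ℕ}
    (hd : ∀ u ∈ gens I, u.degree = d) {x : reesAlgebra I}
    (hx : x ∈ (idealOfVars (Fin n) K).map (algebraMap _ (reesAlgebra I))) (k : ℕ) :
    x.1.coeff k ∈ idealOfVars (Fin n) K ^ (d * k + 1) := by
  revert k
  rw [Ideal.map] at hx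
  induction hx using Submodule.span_induction with
  | mem x hx =>
    obtain ⟨y, hy, rfl⟩ := hx
    intro k
    change (Polynomial.C y).coeff k ∈ _
    rw [Polynomial.coeff_C]
    split_ifs with h
    · subst h
      simpa using hy
    · exact zero_mem _
  | zero => intro k; simp
  | add x y _ _ hx hy =>
    intro k
    rw [AddMemClass.coe_add, Polynomial.coeff_add]
    exact add_mem (hx k) (hy k)
  | smul r x _ hx =>
    intro k
    rw [smul_eq_mul, MulMemClass.coe_mul, Polynomial.coeff_mul]
    refine sum_mem fun p hp => ?_
    have h1 := Ideal.pow_right_mono (le_pow_idealOfVars hI hd) p.1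
      ((mem_reesAlgebra_iff I r.1).1 r.2 p.1)
    rw [← pow_mul] at h1
    have h2 := Ideal.mul_mem_mul h1 (hx p.2)
    rw [← pow_add] at h2
    rw [← Finset.HasAntidiagonal.mem_antidiagonal.1 hp]
    convert h2 using 2
    ring

theorem coeff_reesMap_isHomogeneous {d : ℕ} (hd : ∀ u ∈ gens I, u.degree = d)
    (f : MvPolynomial (gens I) K) (k : ℕ) :
    ((reesMap I (MvPolynomial.map C f)).1.coeff k).IsHomogeneous (d * k) := by
  induction f using MvPolynomial.induction_on' with
  | monomial m a =>
    obtain ⟨p, U, hU⟩ := exists_family (G := gens I) (R := MvPolynomial (Fin n) K) m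
    have h1 : (monomial m (C a) : MvPolynomial (gens I) (MvPolynomial (Fin n) K)) =
        C (C a) * monomial m 1 := by
      rw [C_mul_monomial, mul_one]
    rw [map_monomial, h1, hU, map_mul, MulMemClass.coe_mul, coe_reesMap_C, coe_reesMap_prod,
      Polynomial.coeff_C_mul, Polynomial.coeff_monomial]
    split_ifs with h
    · subst h
      rw [mon, C_mul_monomial]
      refine isHomogeneous_monomial _ ?_
      rw [total, map_sum, Finset.sum_congr rfl fun c _ => hd _ (U c).2]
      simp [mul_comm]
    · rw [mul_zero]
      exact isHomogeneous_zero _ _ _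
  | add p q hp hq =>
    rw [map_add, map_add, AddMemClass.coe_add, Polynomial.coeff_add]
    exact hp.add hq

theorem fiberIdeal_eq (hI : IsMonomialIdeal I) {d : ℕ} (hd : ∀ u ∈ gens I, u.degree = d)
    (h : toricIdeal I = Ideal.span (exchangeRelations I)) :
    fiberIdeal I = Ideal.span (exchangeRelations I) := by
  refine le_antisymm (fun f hf => ?_) ?_
  · rw [← h]
    have hf' : reesMap I (MvPolynomial.map C f) ∈
        (idealOfVars (Fin n) K).map (algebraMap _ (reesAlgebra I)) :=
      Ideal.Quotient.eq_zero_iff_mem.1 hf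
    have h0 : (reesMap I (MvPolynomial.map C f)).1 = 0 := by
      ext1 k
      rw [Polynomial.coeff_zero]
      by_contra hne
      obtain ⟨m, hm⟩ := ne_zero_iff.1 hne
      have h1 := coeff_reesMap_isHomogeneous hd f k hm
      have h2 := (mem_pow_idealOfVars_iff _ _).1 (coeff_mem_of_mem_map hI hd hf' k) m
        (mem_support_iff.2 hm)
      have h4 : m.degree = d * k := by rw [Finsupp.degree_eq_weight_one]; exact h1
      omega
    have h3 : ∀ g : MvPolynomial (gens I) K,
        Polynomial.eval 1 (reesMap I (MvPolynomial.map C g)).1 =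
          aeval (fun u : gens I => mon K u.1) g := by
      intro g
      induction g using MvPolynomial.induction_on with
      | C a =>
        rw [map_C, coe_reesMap_C, Polynomial.eval_C, algHom_C]
        rfl
      | add p q hp hq =>
        rw [map_add, map_add, AddMemClass.coe_add, Polynomial.eval_add, hp, hq, map_add]
      | mul_X p u hp =>
        rw [map_mul, map_mul, MulMemClass.coe_mul, Polynomial.eval_mul, hp, map_mul, map_X,
          coe_reesMap_X, Polynomial.eval_monomial, aeval_X, one_pow, mul_one]
    change aeval (fun u : gens I => mon K u.1) f = 0
    rw [← h3, h0, Polynomial.eval_zero]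
  · rw [Ideal.span_le]
    intro f hf
    have h1 : reesMap I (MvPolynomial.map C f) = 0 :=
      reesRelations_le I (Ideal.subset_span (Or.inl ⟨f, hf, rfl⟩))
    change Ideal.Quotient.mk _ (reesMap I (MvPolynomial.map C f)) = 0
    rw [h1, map_zero]

end Fiber
end SymShifted
namespace SymShifted

section Majorization

open Finset

variable {n : ℕ}

theorem sum_le_prefixSum {ℓ : ℕ → ℕ} (hℓ : Antitone ℓ) (B : Finset ℕ) :
    ∑ q ∈ B, ℓ q ≤ prefixSum ℓ B.card := by
  induction B using Finset.induction_on_max with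
  | empty => simp [prefixSum]
  | insert a B hmax ih =>
    have ha : a ∉ B := fun h => lt_irrefl _ (hmax a h)
    have hcard : B.card ≤ a := by
      have := card_le_card (fun x hx => mem_range.2 (hmax x hx) : B ⊆ range a)
      rwa [card_range] at this
    rw [sum_insert ha, card_insert_of_notMem ha, prefixSum, sum_range_succ, add_comm]
    exact add_le_add ih (hℓ hcard)

/-- The extension by zero of a vector to a sequence. -/
def extendZero (w : Fin n →₀ ℕ) (q : ℕ) : ℕ := if h : q < n then w ⟨q, h⟩ else 0

theorem extendZero_val (w : Fin n →₀ ℕ) (i : Fin n) : extendZero w i = w i := by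
  simp [extendZero]

theorem antitone_extendZero {w : Fin n →₀ ℕ} (hw : Antitone w) : Antitone (extendZero w) := by
  intro p q hpq
  unfold extendZero
  split_ifs with h1 h2
  · exact hw (by simpa using hpq)
  · omega
  · exact Nat.zero_le _
  · exact le_rfl

theorem prefixSum_extendZero (w : Fin n →₀ ℕ) {p : ℕ} (hp : p ≤ n) :
    prefixSum (extendZero w) p = ∑ l ∈ univ.filter (fun l : Fin n => l.1 < p), w l := by
  have : range p = (univ.filter fun l : Fin n => l.1 < p).map Fin.valEmbedding := by
    ext q
    simp only [mem_range, mem_map, mem_filter, mem_univ, true_and, Fin.valEmbedding_apply]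
    exact ⟨fun h => ⟨⟨q, by omega⟩, h, rfl⟩, fun ⟨a, ha, h⟩ => h ▸ ha⟩
  rw [prefixSum, this, sum_map]
  exact sum_congr rfl fun l _ => extendZero_val w l

theorem prefixSum_extendZero_self (w : Fin n →₀ ℕ) :
    prefixSum (extendZero w) n = w.degree := by
  rw [prefixSum_extendZero w le_rfl, Finsupp.degree_eq_sum]
  simp

theorem mem_base_extendZero {w : Fin n →₀ ℕ} (hw : Antitone w) : w ∈ base n (extendZero w) := by
  refine ⟨(prefixSum_extendZero_self w).symm, fun A => ?_⟩
  have := sum_le_prefixSum (antitone_extendZero hw) (A.map Fin.valEmbedding)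
  rw [sum_map, card_map] at this
  simpa [extendZero_val] using this

theorem mapDomain_transfer (σ : Equiv.Perm (Fin n)) (u : Fin n →₀ ℕ) (i j : Fin n) :
    Finsupp.mapDomain σ (transfer u i j) = transfer (Finsupp.mapDomain σ u) (σ i) (σ j) := by
  ext l
  simp [Finsupp.mapDomain_equiv_apply, transfer, Finsupp.single_apply, Equiv.eq_symm_apply]

theorem exists_perm_lt (A : Finset (Fin n)) : ∃ σ : Equiv.Perm (Fin n), ∀ i, (σ i).1 < A.card ↔
    i ∈ A := by
  have hA : A.card ≤ n := by simpa using A.card_le_univ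
  have hcard : Fintype.card {i // i ∈ A} = Fintype.card {i : Fin n // i.1 < A.card} := by
    rw [Fintype.card_coe, Fintype.card_subtype, Fin.card_filter_val_lt, min_eq_right hA]
  let e := Fintype.equivOfCardEq hcard
  refine ⟨e.extendSubtype, fun i => ⟨fun h => ?_, fun h => ?_⟩⟩
  · by_contra hi
    exact Equiv.extendSubtype_not_mem e i hi h
  · exact Equiv.extendSubtype_mem e i h

/-- A nonempty set of vectors of constant degree which is symmetric and satisfies the exchange
property consists of all vectors majorized by one of its members. -/
theorem exists_eq_base {G : Set (Fin n →₀ ℕ)} {d : ℕ} (hdeg : ∀ u ∈ G, u.degree = d)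
    (hperm : ∀ u ∈ G, ∀ σ : Equiv.Perm (Fin n), Finsupp.mapDomain σ u ∈ G)
    (hex : ∀ u ∈ G, ∀ v ∈ G, ∀ i, v i < u i → ∃ j, u j < v j ∧ transfer u i j ∈ G)
    (hne : G.Nonempty) : ∃ ℓ : ℕ → ℕ, Antitone ℓ ∧ G = base n ℓ := by
  have htr : ∀ u ∈ G, ∀ i j, u j < u i → transfer u i j ∈ G := by
    intro u hu i j hij
    have hswap : ∀ l, Finsupp.mapDomain (Equiv.swap i j) u l = u (Equiv.swap i j l) := fun l => by
      rw [Finsupp.mapDomain_equiv_apply, Equiv.symm_swap]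
    obtain ⟨p, hp, hmem⟩ := hex u hu _ (hperm u hu (Equiv.swap i j)) i
      (by rw [hswap, Equiv.swap_apply_left]; exact hij)
    rw [hswap] at hp
    by_cases h1 : p = j
    · rwa [h1] at hmem
    by_cases h2 : p = i
    · rw [h2, Equiv.swap_apply_left] at hp
      omega
    rw [Equiv.swap_apply_of_ne_of_ne h2 h1] at hp
    omega
  obtain ⟨w, hw, hmin⟩ := exists_minimalFor_of_wellFoundedLT (· ∈ G)
    (fun u => ∑ l, l.1 * u l) hne
  have hleft : ∀ i j, 0 < w i → transfer w i j ∈ G → i ≤ j := by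
    intro i j hi hmem
    by_contra hji
    push Not at hji
    have h1 := sum_apply_transfer (u := w) hji.ne' (fun l x => l.1 * x)
    obtain ⟨x, hx⟩ := Nat.exists_eq_succ_of_ne_zero hi.ne'
    simp only [hx, Nat.succ_sub_one] at h1
    have h2 : j.1 < i.1 := hji
    have h3 : ∑ l, l.1 * transfer w i j l < ∑ l, l.1 * w l := by nlinarith
    exact absurd h3 (not_lt.2 (hmin hmem h3.le))
  have hanti : Antitone w := by
    intro i j hij
    by_contra! hlt
    have := hleft j i (by omega) (htr w hw j i hlt)
    obtain rfl := le_antisymm hij this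
    omega
  have hprefix : ∀ p N v, v ∈ G → ∑ l, (v l - w l) = N →
      ∑ l ∈ univ.filter (fun l : Fin n => l.1 < p), v l ≤
        ∑ l ∈ univ.filter (fun l : Fin n => l.1 < p), w l := by
    intro p N
    induction N using Nat.strong_induction_on with
    | _ N ih =>
      intro v hv hN
      by_contra! hlt
      by_cases hi : ∃ i : Fin n, p ≤ i.1 ∧ w i < v i
      · obtain ⟨i, hpi, hi⟩ := hi
        obtain ⟨j, hj, hmem⟩ := hex v hv w hw i hi
        have hij : i ≠ j := by rintro rfl; omega
        have h1 := sum_apply_transfer (u := v) hij (fun l x => x - w l)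
        have h2 := ih _ (by omega) _ hmem rfl
        have h3 := sum_transfer j (Nat.zero_lt_of_lt hi) (univ.filter fun l : Fin n => l.1 < p)
        rw [if_neg (by simpa using hpi)] at h3
        omega
      · push Not at hi
        have htot : ∑ l, v l = ∑ l, w l := by
          rw [← Finsupp.degree_eq_sum, ← Finsupp.degree_eq_sum, hdeg v hv, hdeg w hw]
        rw [← sum_filter_add_sum_filter_not univ (fun l : Fin n => l.1 < p),
          ← sum_filter_add_sum_filter_not univ (fun l : Fin n => l.1 < p) w] at htot
        obtain ⟨i, hip, hilt⟩ := exists_lt_of_sum_lt (s := univ.filter fun l : Fin n => ¬ l.1 < p)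
          (f := v) (g := w) (by omega)
        simp only [mem_filter, mem_univ, true_and, not_lt] at hip
        obtain ⟨j, hj, hmem⟩ := hex w hw v hv i hilt
        have h1 := hleft i j (by omega) hmem
        have h2 := hi j (hip.trans h1)
        omega
  refine ⟨extendZero w, antitone_extendZero hanti, Set.Subset.antisymm (fun v hv => ?_) ?_⟩
  · refine ⟨by rw [hdeg v hv, prefixSum_extendZero_self, hdeg w hw], fun A => ?_⟩
    obtain ⟨σ, hσ⟩ := exists_perm_lt A
    have hA : A.card ≤ n := by simpa using A.card_le_univ
    have h1 := hprefix A.card _ _ (hperm v hv σ) rfl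
    rw [← prefixSum_extendZero w hA] at h1
    refine le_trans (le_of_eq ?_) h1
    refine sum_equiv σ (fun i => by simp [hσ]) fun i _ => ?_
    rw [Finsupp.mapDomain_equiv_apply, Equiv.symm_apply_apply]
  · exact base_subset (antitone_extendZero hanti) hperm htr (fun i => (extendZero_val w i).symm)
      (mem_base_extendZero hanti) hw

end Majorization

section Ideals

open MvPolynomial

variable {K : Type*} [Field K] {n : ℕ} {I : Ideal (MvPolynomial (Fin n) K)}

theorem mon_mem_of_mem_gens {u : Fin n →₀ ℕ} (hu : u ∈ gens I) : mon K u ∈ I :=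
  (show Minimal (fun b => mon K b ∈ I) u from hu).prop

theorem mon_mem_span_iff {B : Set (Fin n →₀ ℕ)} {a : Fin n →₀ ℕ} :
    mon K a ∈ Ideal.span (mon K '' B) ↔ ∃ b ∈ B, b ≤ a := by
  classical
  have : mon K a ∈ Ideal.span (mon K '' B) ↔ _ :=
    mem_ideal_span_monomial_image (x := mon K a) (s := B)
  rw [this, mon, support_monomial, if_neg one_ne_zero]
  simp

theorem IsSymmetric.mon_mem (hI : IsSymmetric I) (σ : Equiv.Perm (Fin n)) {a : Fin n →₀ ℕ}
    (ha : mon K a ∈ I) : mon K (Finsupp.mapDomain σ a) ∈ I := by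
  have := Ideal.mem_map_of_mem (rename σ : MvPolynomial (Fin n) K →ₐ[K] _) ha
  rw [hI σ, mon, rename_monomial] at this
  exact this

theorem eq_of_le_of_degree_eq {u v : Fin n →₀ ℕ} (h : u ≤ v) (hd : u.degree = v.degree) :
    u = v := by
  obtain ⟨z, rfl⟩ := exists_add_of_le h
  rw [map_add, left_eq_add, Finsupp.degree_eq_zero_iff] at hd
  rw [hd, add_zero]

theorem mem_gens_of_degree {d : ℕ} (hd : ∀ u ∈ gens I, u.degree = d) {a : Fin n →₀ ℕ}
    (ha : mon K a ∈ I) (had : a.degree = d) : a ∈ gens I := by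
  obtain ⟨u, hu, hle⟩ := exists_gens_le ha
  rwa [← eq_of_le_of_degree_eq hle ((hd u hu).trans had.symm)]

theorem gens_span {B : Set (Fin n →₀ ℕ)} {d : ℕ} (hB : ∀ u ∈ B, u.degree = d) :
    gens (Ideal.span (mon K '' B)) = B := by
  ext a
  constructor
  · intro ha
    have ha' : Minimal (fun b => mon K b ∈ Ideal.span (mon K '' B)) a := ha
    obtain ⟨b, hb, hle⟩ := mon_mem_span_iff.1 ha'.prop
    have := ha'.le_of_le (mon_mem_span_iff.2 ⟨b, hb, le_rfl⟩) hle
    rwa [le_antisymm this hle]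
  · intro ha
    refine ⟨mon_mem_span_iff.2 ⟨a, ha, le_rfl⟩, fun b hb hle => ?_⟩
    obtain ⟨c, hc, hcb⟩ := mon_mem_span_iff.1 hb
    rw [← eq_of_le_of_degree_eq (hcb.trans hle) ((hB c hc).trans (hB a ha).symm)]
    exact hcb

theorem IsSssi.mon_transfer_mem (hI : IsSssi I) {u : Fin n →₀ ℕ} (hu : mon K u ∈ I) {i j : Fin n}
    (hij : u j < u i) : mon K (transfer u i j) ∈ I := by
  set σ := Tuple.sort u
  have hmono : Monotone (u ∘ σ) := Tuple.monotone_sort u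
  set x := Finsupp.mapDomain σ.symm u with hx
  have hxap : ∀ p, x p = u (σ p) := fun p => by simp [hx, Finsupp.mapDomain_equiv_apply]
  have hxm : Monotone x := fun p q h => by rw [hxap, hxap]; exact hmono h
  have hlt : x (σ.symm j) < x (σ.symm i) := by simpa [hxap] using hij
  have h1 := hI.shifted x ⟨hxm, hI.symmetric.mon_mem _ hu⟩ _ _ (hxm.reflect_lt hlt) hlt
  have h2 := hI.symmetric.mon_mem σ h1
  change mon K (Finsupp.mapDomain σ (transfer x (σ.symm i) (σ.symm j))) ∈ I at h2
  rw [mapDomain_transfer, Equiv.apply_symm_apply, Equiv.apply_symm_apply] at h2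
  convert h2 using 2
  congr 1
  ext p
  simp [Finsupp.mapDomain_equiv_apply, hxap]

theorem isSymmetric_span {B : Set (Fin n →₀ ℕ)}
    (hB : ∀ u ∈ B, ∀ σ : Equiv.Perm (Fin n), Finsupp.mapDomain σ u ∈ B) :
    IsSymmetric (Ideal.span (mon K '' B)) := by
  intro σ
  rw [Ideal.map_span, ← Set.image_comp]
  congr 1
  ext f
  constructor
  · rintro ⟨u, hu, rfl⟩
    exact ⟨_, hB u hu σ, (rename_monomial σ u (1 : K)).symm⟩
  · rintro ⟨u, hu, rfl⟩
    refine ⟨_, hB u hu σ.symm, ?_⟩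
    change rename σ (monomial _ (1 : K)) = _
    rw [rename_monomial, ← Finsupp.mapDomain_comp, Equiv.self_comp_symm, Finsupp.mapDomain_id]
    rfl

theorem isSssi_span_base (ℓ : ℕ → ℕ) : IsSssi (Ideal.span (mon K '' base n ℓ)) where
  monomialIdeal := ⟨_, rfl⟩
  symmetric := isSymmetric_span fun _ hu σ => mapDomain_mem_base σ hu
  shifted := by
    rintro a ⟨-, ha⟩ i j hij hlt
    change mon K (transfer a j i) ∈ _
    obtain ⟨u, hu, hle⟩ := mon_mem_span_iff.1 ha
    have hi := hle i
    have hj := hle j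
    rw [mon_mem_span_iff]
    rcases hj.lt_or_eq with h | h
    · refine ⟨u, hu, fun l => ?_⟩
      by_cases h1 : l = j
      · rw [h1, transfer_src hij.ne']
        omega
      by_cases h2 : l = i
      · rw [h2, transfer_tgt hij.ne']
        omega
      rw [transfer_of_ne h1 h2]
      exact hle l
    · refine ⟨transfer u j i, transfer_mem_base_of_lt hu (by omega), fun l => ?_⟩
      by_cases h1 : l = j
      · rw [h1, transfer_src hij.ne', transfer_src hij.ne']
        omega
      by_cases h2 : l = i
      · rw [h2, transfer_tgt hij.ne', transfer_tgt hij.ne']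
        omega
      rw [transfer_of_ne h1 h2, transfer_of_ne h1 h2]
      exact hle l

/-- Principal Borel ideals are generated by all monomials majorized by their generator. -/
theorem IsPrincipalBorel.exists_gens_eq_base (hI : IsPrincipalBorel I) :
    ∃ ℓ : ℕ → ℕ, Antitone ℓ ∧ gens I = base n ℓ ∧ (gens I).Nonempty := by
  obtain ⟨-, a, ⟨ha, hIa⟩, -⟩ := hI
  have hmono : Monotone a := ha rfl
  set w := Finsupp.mapDomain Fin.revPerm a with hw
  have hwap : ∀ i, w i = a (Fin.rev i) := fun i => by
    rw [hw, Finsupp.mapDomain_equiv_apply]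
    rfl
  have hanti : Antitone w := fun i j hij => by
    rw [hwap, hwap]
    exact hmono (Fin.rev_le_rev.2 hij)
  have hwb := mem_base_extendZero hanti
  have haw : a = Finsupp.mapDomain Fin.revPerm w := by
    ext i
    rw [Finsupp.mapDomain_equiv_apply, hwap, Fin.revPerm_symm, Fin.revPerm_apply, Fin.rev_rev]
  have hIb : I = Ideal.span (mon K '' base n (extendZero w)) := by
    rw [hIa]
    refine le_antisymm (sInf_le ⟨isSssi_span_base _, ?_⟩) (le_sInf fun J hJ => ?_)
    · rintro _ ⟨b, hb, rfl⟩
      rw [Set.mem_singleton_iff.1 hb]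
      exact Ideal.subset_span ⟨a, haw ▸ mapDomain_mem_base _ hwb, rfl⟩
    · have hsub : base n (extendZero w) ⊆ {u | mon K u ∈ J} :=
        base_subset (antitone_extendZero hanti) (fun u hu σ => hJ.1.symmetric.mon_mem σ hu)
          (fun u hu i j hij => hJ.1.mon_transfer_mem hu hij)
          (fun i => (extendZero_val w i).symm) hwb
          (hJ.1.symmetric.mon_mem _ (hJ.2 ⟨a, rfl, rfl⟩))
      rw [Ideal.span_le]
      rintro _ ⟨u, hu, rfl⟩
      exact hsub hu
  have hgens : gens I = base n (extendZero w) := by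
    rw [hIb]
    exact gens_span fun u hu => hu.1
  exact ⟨_, antitone_extendZero hanti, hgens, hgens ▸ ⟨w, hwb⟩⟩

/-- Nonzero symmetric polymatroidal ideals are generated by all monomials majorized by one
monomial. -/
theorem IsPolymatroidal.exists_gens_eq_base (hsym : IsSymmetric I) (hI : IsPolymatroidal I)
    (hne : (gens I).Nonempty) : ∃ ℓ : ℕ → ℕ, Antitone ℓ ∧ gens I = base n ℓ := by
  obtain ⟨u₀, hu₀⟩ := hne
  have hd : ∀ u ∈ gens I, u.degree = u₀.degree := fun u hu => hI.equigenerated u hu u₀ hu₀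
  refine exists_eq_base hd (fun u hu σ => ?_) (fun u hu v hv i hi => ?_) ⟨u₀, hu₀⟩
  · refine mem_gens_of_degree hd (hsym.mon_mem σ (mon_mem_of_mem_gens hu)) ?_
    rw [← hd u hu, Finsupp.degree_eq_sum, Finsupp.degree_eq_sum]
    simp only [Finsupp.mapDomain_equiv_apply]
    exact Equiv.sum_comp σ.symm u
  · obtain ⟨j, hj, hmem⟩ := hI.exchange u hu v hv i hi
    exact ⟨j, hj, mem_gens_of_degree hd hmem
      ((degree_transfer j (Nat.zero_lt_of_lt hi)).trans (hd u hu))⟩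

theorem prefixSum_pos {ℓ : ℕ → ℕ} (hI : I ≠ ⊤) (hG : gens I = base n ℓ)
    (hne : (gens I).Nonempty) : 0 < prefixSum ℓ n := by
  obtain ⟨u, hu⟩ := hne
  refine Nat.pos_of_ne_zero fun h0 => hI ?_
  have h1 : u.degree = 0 := by rw [← h0]; exact (hG ▸ hu : u ∈ base n ℓ).1
  rw [Finsupp.degree_eq_zero_iff] at h1
  rw [Ideal.eq_top_iff_one]
  have h2 : mon K u ∈ I := mon_mem_of_mem_gens hu
  rwa [h1] at h2

theorem toricIdeal_eq_of_isEmpty (h : ¬ (gens I).Nonempty) :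
    toricIdeal I = Ideal.span (exchangeRelations I) := by
  refine le_antisymm (fun f hf => ?_) (span_exchangeRelations_le I)
  have : IsEmpty (gens I) := Set.isEmpty_coe_sort.2 (Set.not_nonempty_iff_eq_empty.1 h)
  obtain ⟨a, rfl⟩ := C_surjective (gens I) f
  have hf' : aeval (fun u : gens I => mon K u.1) (C a : MvPolynomial (gens I) K) = 0 := hf
  rw [algHom_C, algebraMap_eq, C_eq_zero] at hf'
  rw [hf', C_0]
  exact zero_mem _

end Ideals

end SymShifted

theorem theorem6p4 {K : Type*} [Field K] {n : ℕ} (I : Ideal (MvPolynomial (Fin n) K))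
    (hI : I ≠ ⊤) :
    (IsPrincipalBorel I →
      toricIdeal I = Ideal.span (exchangeRelations I) ∧
      fiberIdeal I = Ideal.span (exchangeRelations I) ∧
      reesIdeal I = Ideal.span
        (MvPolynomial.map MvPolynomial.C '' exchangeRelations I ∪ syzygyRelations I)) ∧
    (IsSymmetric I → IsPolymatroidal I →
      toricIdeal I = Ideal.span (exchangeRelations I)) := by
  constructor
  · intro h
    obtain ⟨ℓ, hℓ, hG, hne⟩ := h.exists_gens_eq_base
    have ht := toricIdeal_eq hℓ hG (prefixSum_pos hI hG hne)
    have hd : ∀ u ∈ gens I, u.degree = prefixSum ℓ n :=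
      fun u hu => (hG ▸ hu : u ∈ base n ℓ).1
    exact ⟨ht, fiberIdeal_eq h.1.monomialIdeal hd ht, reesIdeal_eq hℓ hG⟩
  · intro hsym hpoly
    by_cases hne : (gens I).Nonempty
    · obtain ⟨ℓ, hℓ, hG⟩ := hpoly.exists_gens_eq_base hsym hne
      exact toricIdeal_eq hℓ hG (prefixSum_pos hI hG hne)
    · exact toricIdeal_eq_of_isEmpty hne
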